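/- Theorem 3.4. Let $\Omega\subseteq\mathbb C$ be open with $0\in\Omega$ and such that $(\mathbb C\cup\{\infty\})\setminus\overline\Omega$ is connected, where $\overline\Omega$ is the closure of $\Omega$ in $\mathbb C$. Let $A^\infty(\Omega)$ be the set of holomorphic functions $f$ on $\Omega$ such that for every $l=0,1,2,\dots$ the derivative $f^{(l)}$ extends continuously to $\overline\Omega$ (the extension is again denoted $f^{(l)}$), with the metric $$\rho(f,g)=\sum_{l=0}^\infty\sum_{n=1}^\infty\frac1{2^{l+n}}\min\Big\{\sup_{z\in\overline\Omega,\ |z|\le n}|f^{(l)}(z)-g^{(l)}(z)|,\,1\Big\}.$$ Let $H(\overline\Omega)\subseteq A^\infty(\Omega)$ be the set of (restrictions to $\Omega$ of) functions holomorphic in some open set containing $\overline\Omega$, and let $X$ be its closure in $(A^\infty(\Omega),\rho)$. For $f$ holomorphic near $0$ with Taylor series $\sum_{v\ge0}a_vz^v$, and $p,q\in\{0,1,2,\dots\}$, write $f\in D_{p,q}$ if $\det\big(a_{p-q+1+i+j}\big)_{0\le i,j<q}\ne0$, where $a_i=0$ for $i<0$ and the empty determinant ($q=0$) is $1$. For $f\in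 D_{p,q}$ let $[p/q]_f=N/D$ be the unique rational function with polynomials $N,D$ satisfying $\deg N\le p$, $\deg D\le q$, $D(0)=1$, whose Taylor coefficients at $0$ of index $0,\dots,p+q$ are $a_0,\dots,a_{p+q}$. Let $F\subseteq\{0,1,2,\dots\}^2$ contain a sequence $(\tilde p_m,\tilde q_m)_{m\in\mathbb N}$ with $\tilde p_m\to+\infty$, and let $B_F$ be the set of $f\in A^\infty(\Omega)$ for which there is a sequence $(p_m,q_m)_{m\in\mathbb N}$ in $F$ such that $f\in D_{p_m,q_m}$ for all $m$ and, for every compact $K\subseteq\overline\Omega$ and every $l=0,1,2,\dots$, $[p_m/q_m]_f^{(l)}\to f^{(l)}$ uniformly on $K$ (in particular, $[p_m/q_m]_f$ has no poles in $K$ for all large $m$). Then $B_F\cap X$ is a $G_\delta$ subset of $X$ and is dense in $X$. In particular $B_F\neq\emptyset$. -/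

import Mathlib

open Set Filter Topology Polynomial

noncomputable section

namespace PadeSmooth

/-- The space `A^∞(Ω)`: holomorphic functions on `Ω` all of whose derivatives extend continuously
to the closure of `Ω`. A function on `Ω` is recorded by its extension by zero to `ℂ`, so that
two elements are equal exactly when they agree on `Ω`; the values off `Ω` carry no information. -/
@[ext]
structure AInf (Ω : Set ℂ) where
  toFun : ℂ → ℂ
  zero_off : ∀ z, z ∉ Ω → toFun z = 0
  holomorphic : DifferentiableOn ℂ toFun Ω
  extends_closure : ∀ l : ℕ, ∃ g : ℂ → ℂ,
    ContinuousOn g (closure Ω) ∧ EqOn g (iteratedDeriv l toFun) Ω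

variable {Ω : Set ℂ}

/-- The `l`-th derivative of `f`, extended by continuity from `Ω` to the closure of `Ω`
(only its values on `closure Ω` are meaningful). -/
def AInf.extDeriv (f : AInf Ω) (l : ℕ) : ℂ → ℂ :=
  extendFrom Ω (iteratedDeriv l f.toFun)

/-- `‖f - g‖_{l,n}`, the supremum of `|f^{(l)} - g^{(l)}|` over `closure Ω ∩ {|z| ≤ n}`. -/
def AInf.seminormDist (f g : AInf Ω) (l n : ℕ) : ℝ :=
  ⨆ z : ↥(closure Ω ∩ Metric.closedBall (0 : ℂ) n), ‖f.extDeriv l z - g.extDeriv l z‖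

/-- The metric `ρ(f,g) = ∑_{l ≥ 0} ∑_{n ≥ 1} 2^{-(l+n)} min(‖f-g‖_{l,n}, 1)`;
the inner sum is indexed by `k = n - 1`. -/
def AInf.rho (f g : AInf Ω) : ℝ :=
  ∑' l : ℕ, ∑' k : ℕ, 1 / 2 ^ (l + (k + 1)) * min (f.seminormDist g l (k + 1)) 1

theorem AInf.extDeriv_continuousOn_eqOn (f : AInf Ω) (l : ℕ) :
    ContinuousOn (f.extDeriv l) (closure Ω) ∧ EqOn (f.extDeriv l) (iteratedDeriv l f.toFun) Ω := by
  obtain ⟨g, hg, hgf⟩ := f.extends_closure l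
  have key : EqOn (f.extDeriv l) g (closure Ω) := by
    intro z hz
    refine extendFrom_eq hz ?_
    refine Tendsto.congr' ?_ ((hg z hz).mono_left (nhdsWithin_mono z subset_closure))
    filter_upwards [self_mem_nhdsWithin] with w hw using hgf hw
  exact ⟨hg.congr key, fun z hz => (key (subset_closure hz)).trans (hgf hz)⟩

theorem AInf.bddAbove_seminormDist (f g : AInf Ω) (l n : ℕ) :
    BddAbove (range fun z : ↥(closure Ω ∩ Metric.closedBall (0 : ℂ) n) =>
      ‖f.extDeriv l z - g.extDeriv l z‖) := by
  have hK : IsCompact (closure Ω ∩ Metric.closedBall (0 : ℂ) n) :=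
    (isCompact_closedBall (0 : ℂ) n).inter_left isClosed_closure
  have hc : ContinuousOn (fun z => ‖f.extDeriv l z - g.extDeriv l z‖)
      (closure Ω ∩ Metric.closedBall (0 : ℂ) n) :=
    (((f.extDeriv_continuousOn_eqOn l).1.sub (g.extDeriv_continuousOn_eqOn l).1).norm).mono
      inter_subset_left
  have := (hK.image_of_continuousOn hc).bddAbove
  rwa [image_eq_range] at this

theorem AInf.seminormDist_nonneg (f g : AInf Ω) (l n : ℕ) : 0 ≤ f.seminormDist g l n :=
  Real.iSup_nonneg fun _ => norm_nonneg _

theorem AInf.seminormDist_triangle (f g h : AInf Ω) (l n : ℕ) :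
    f.seminormDist h l n ≤ f.seminormDist g l n + g.seminormDist h l n := by
  refine Real.iSup_le (fun z => ?_)
    (add_nonneg (f.seminormDist_nonneg g l n) (g.seminormDist_nonneg h l n))
  have h1 := le_ciSup (f.bddAbove_seminormDist g l n) z
  have h2 := le_ciSup (g.bddAbove_seminormDist h l n) z
  exact (norm_sub_le_norm_sub_add_norm_sub _ (g.extDeriv l z) _).trans (add_le_add h1 h2)

theorem AInf.rho_term_nonneg (f g : AInf Ω) (l k : ℕ) :
    0 ≤ 1 / 2 ^ (l + (k + 1)) * min (f.seminormDist g l (k + 1)) 1 :=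
  mul_nonneg (by positivity) (le_min (f.seminormDist_nonneg g _ _) zero_le_one)

theorem AInf.rho_term_le (f g : AInf Ω) (l k : ℕ) :
    1 / 2 ^ (l + (k + 1)) * min (f.seminormDist g l (k + 1)) 1
      ≤ (1 / 2 : ℝ) ^ l * ((1 / 2) ^ k * (1 / 2)) := by
  calc _ ≤ 1 / 2 ^ (l + (k + 1)) * (1 : ℝ) := by gcongr; exact min_le_right _ _
    _ = _ := by rw [mul_one, pow_add, pow_succ]; simp [one_div]; ring

theorem AInf.rho_inner_summable (f g : AInf Ω) (l : ℕ) :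
    Summable fun k : ℕ => 1 / 2 ^ (l + (k + 1)) * min (f.seminormDist g l (k + 1)) 1 :=
  Summable.of_nonneg_of_le (f.rho_term_nonneg g l) (f.rho_term_le g l)
    ((summable_geometric_two.mul_right _).mul_left _)

theorem AInf.rho_outer_summable (f g : AInf Ω) :
    Summable fun l : ℕ =>
      ∑' k : ℕ, 1 / 2 ^ (l + (k + 1)) * min (f.seminormDist g l (k + 1)) 1 := by
  refine Summable.of_nonneg_of_le (fun l => tsum_nonneg (f.rho_term_nonneg g l))
    (fun l => (f.rho_inner_summable g l).tsum_le_tsum (f.rho_term_le g l)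
      ((summable_geometric_two.mul_right _).mul_left _)) ?_
  simp only [tsum_mul_left]
  exact summable_geometric_two.mul_right _

/-- `A^∞(Ω)` is equipped with the metric `ρ`. -/
instance : MetricSpace (AInf Ω) where
  dist := AInf.rho
  dist_self f := by simp [AInf.rho, AInf.seminormDist]
  dist_comm f g := by simp only [AInf.rho, AInf.seminormDist, norm_sub_rev]
  dist_triangle f g h := by
    change f.rho h ≤ f.rho g + g.rho h
    unfold AInf.rho
    rw [← (f.rho_outer_summable g).tsum_add (g.rho_outer_summable h)]
    refine (f.rho_outer_summable h).tsum_le_tsum (fun l => ?_)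
      ((f.rho_outer_summable g).add (g.rho_outer_summable h))
    rw [← (f.rho_inner_summable g l).tsum_add (g.rho_inner_summable h l)]
    refine (f.rho_inner_summable h l).tsum_le_tsum (fun k => ?_)
      ((f.rho_inner_summable g l).add (g.rho_inner_summable h l))
    rw [← mul_add]
    refine mul_le_mul_of_nonneg_left ?_ (by positivity)
    have h1 := f.seminormDist_triangle g h l (k + 1)
    have h2 := f.seminormDist_nonneg g l (k + 1)
    have h3 := g.seminormDist_nonneg h l (k + 1)
    grind
  eq_of_dist_eq_zero := by
    intro f g hfg
    change (∑' l : ℕ, ∑' k : ℕ, 1 / 2 ^ (l + (k + 1)) *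
      min (f.seminormDist g l (k + 1)) 1) = 0 at hfg
    have h1 := (hasSum_zero_iff_of_nonneg fun l => tsum_nonneg (f.rho_term_nonneg g l)).1
      (hfg ▸ (f.rho_outer_summable g).hasSum)
    have h2 : ∀ k, 1 / 2 ^ (0 + (k + 1)) * min (f.seminormDist g 0 (k + 1)) 1 = 0 := by
      have := (hasSum_zero_iff_of_nonneg (f.rho_term_nonneg g 0)).1
        ((congrFun h1 0) ▸ (f.rho_inner_summable g 0).hasSum)
      exact fun k => congrFun this k
    ext z
    by_cases hz : z ∈ Ω
    · obtain ⟨k, hk⟩ := exists_nat_ge ‖z‖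
      have h3 : f.seminormDist g 0 (k + 1) = 0 := by
        have h4 : min (f.seminormDist g 0 (k + 1)) 1 = 0 :=
          (mul_eq_zero.1 (h2 k)).resolve_left (by positivity)
        grind
      have hzK : z ∈ closure Ω ∩ Metric.closedBall (0 : ℂ) ((k + 1 : ℕ) : ℝ) :=
        ⟨subset_closure hz, by rw [mem_closedBall_zero_iff]; push_cast; linarith⟩
      have h5 := le_ciSup (f.bddAbove_seminormDist g 0 (k + 1)) ⟨z, hzK⟩
      have h6 : ‖f.extDeriv 0 z - g.extDeriv 0 z‖ ≤ 0 := h5.trans h3.le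
      have h7 := sub_eq_zero.1 (norm_le_zero_iff.1 h6)
      rw [(f.extDeriv_continuousOn_eqOn 0).2 hz, (g.extDeriv_continuousOn_eqOn 0).2 hz] at h7
      simpa using h7
    · rw [f.zero_off z hz, g.zero_off z hz]

/-- `H(closure Ω)` inside `A^∞(Ω)`: the restrictions to `Ω` of the functions that are holomorphic
in some open set containing the closure of `Ω`. -/
def HClosure (Ω : Set ℂ) : Set (AInf Ω) :=
  {f | ∃ (U : Set ℂ) (h : ℂ → ℂ), IsOpen U ∧ closure Ω ⊆ U ∧ DifferentiableOn ℂ h U ∧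
    EqOn f.toFun h Ω}

/-- The Taylor coefficients of `f` at `0`. -/
def taylorCoeff (f : ℂ → ℂ) (v : ℕ) : ℂ :=
  iteratedDeriv v f 0 / (Nat.factorial v : ℂ)

/-- The Taylor coefficients of `f` at `0` with the convention `a_i = 0` for `i < 0`. -/
def taylorCoeffInt (f : ℂ → ℂ) (i : ℤ) : ℂ :=
  if i < 0 then 0 else taylorCoeff f i.toNat

/-- `f ∈ D_{p,q}`: the `q × q` determinant with entries `a_{p-q+1+i+j}`, `0 ≤ i, j < q`, is not
zero. For `q = 0` the determinant is empty, equal to `1`, and every `f` is in `D_{p,0}`. -/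
def InD (f : ℂ → ℂ) (p q : ℕ) : Prop :=
  (Matrix.of fun i j : Fin q =>
    taylorCoeffInt f ((p : ℤ) - (q : ℤ) + 1 + (i : ℕ) + (j : ℕ))).det ≠ 0

/-- `N / D` is a Padé approximant of type `[p/q]` of `f`: `deg N ≤ p`, `deg D ≤ q`, the constant
term of `D` is `1`, and the Taylor series of `N / D` at `0` (the power series `N D⁻¹`) agrees
with that of `f` in the coefficients of index `0, …, p + q`. For `f ∈ D_{p,q}` there is exactly
one such pair `(N, D)`, and `N`, `D` have no common zero. -/
structure IsPade (f : ℂ → ℂ) (p q : ℕ) (N D : ℂ[X]) : Prop where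
  natDegree_num_le : N.natDegree ≤ p
  natDegree_den_le : D.natDegree ≤ q
  den_coeff_zero : D.coeff 0 = 1
  coeff_eq : ∀ v ≤ p + q,
    PowerSeries.coeff v ((N : PowerSeries ℂ) * (D : PowerSeries ℂ)⁻¹) = taylorCoeff f v

/-- The class `B_F`: those `f ∈ A^∞(Ω)` for which there is a sequence `(p_m, q_m)` in `F` with
`f ∈ D_{p_m,q_m}` for all `m` and `[p_m/q_m]_f^{(l)} → f^{(l)}` uniformly on `K`, for all compact
`K ⊆ closure Ω` and all `l`. The approximants are written `N m / D m`; uniform convergence on `K`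
includes that they have no pole in `K` for all large `m`. -/
def BF (Ω : Set ℂ) (F : Set (ℕ × ℕ)) : Set (AInf Ω) :=
  {f | ∃ (p q : ℕ → ℕ) (N D : ℕ → ℂ[X]),
    (∀ m, (p m, q m) ∈ F ∧ InD f.toFun (p m) (q m) ∧ IsPade f.toFun (p m) (q m) (N m) (D m)) ∧
    ∀ K ⊆ closure Ω, IsCompact K →
      (∀ᶠ m in atTop, ∀ z ∈ K, (D m).eval z ≠ 0) ∧
      ∀ l : ℕ, TendstoUniformlyOn
        (fun m => iteratedDeriv l fun z => (N m).eval z / (D m).eval z) (f.extDeriv l) atTop K}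

end PadeSmooth

/-!
For each `s` let `G s` be the set of `f` for which some `(p, q) ∈ F` has `f ∈ D_{p,q}` and
`[p/q]_f` pole-free and `1 / (s + 1)`-close to `f` on `closure Ω ∩ {|z| ≤ s}` in all derivatives of
order at most `s`. Then `B_F = ⋂ s, G s`, and Baire's theorem applies in the complete space `X`.

* `G s` is open: by Cramer's rule the coefficients of `[p/q]_f` depend continuously on the Taylor
  coefficients of `f`, and locally uniform convergence of holomorphic functions passes to their
  derivatives.
* `G s` is dense in `X`: by Runge's theorem polynomials are dense in `X`, and a polynomial `P` is
  the limit, as `ε → 0`, of `P + ε X ^ p` with `p > deg P`, which is its own Padé approximant of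
  type `[p/q]` for every `q`.

For Runge's theorem let `K = closure Ω ∩ {|z| ≤ s}`. In the Banach algebra `P(K)` of uniform limits
of polynomials on `K`, the spectrum of the coordinate function has its frontier in `K`, and hence
equals `K` because `closure Ω` has connected complement in the sphere. So `1 / (a - z)` lies in
`P(K)` for `a ∉ K`, and the Cauchy–Pompeiu formula writes a function holomorphic near `K` as an
integral of such Cauchy kernels.
-/

noncomputable section

namespace PadeSmooth

variable {Ω : Set ℂ}

section IteratedDeriv

variable {E : Type*} [NormedAddCommGroup E] [NormedSpace ℂ E] [CompleteSpace E] {U : Set ℂ}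

theorem differentiableOn_iteratedDeriv {f : ℂ → E} (hf : DifferentiableOn ℂ f U) (hU : IsOpen U)
    (l : ℕ) : DifferentiableOn ℂ (iteratedDeriv l f) U := by
  induction l with
  | zero => simpa using hf
  | succ l ih => rw [iteratedDeriv_succ]; exact ih.deriv hU

theorem tendstoLocallyUniformlyOn_iteratedDeriv {ι : Type*} {φ : Filter ι} {F : ι → ℂ → E}
    {f : ℂ → E} (h : TendstoLocallyUniformlyOn F f φ U)
    (hF : ∀ᶠ i in φ, DifferentiableOn ℂ (F i) U) (hU : IsOpen U) (l : ℕ) :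
    TendstoLocallyUniformlyOn (fun i => iteratedDeriv l (F i)) (iteratedDeriv l f) φ U := by
  induction l with
  | zero => simpa using h
  | succ l ih =>
    simp only [iteratedDeriv_succ]
    exact ih.deriv (hF.mono fun i hi => differentiableOn_iteratedDeriv hi hU l) hU

theorem tendstoUniformlyOn_iteratedDeriv_of_continuousAt {Y : Type*} [TopologicalSpace Y]
    {R : Y → ℂ → E} {y₀ : Y} {K : Set ℂ} (hU : IsOpen U) (hK : IsCompact K) (hKU : K ⊆ U)
    (hcont : ∀ z ∈ U, ContinuousAt (Function.uncurry R) (y₀, z))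
    (hdiff : ∀ z ∈ U, ∀ᶠ x : Y × ℂ in 𝓝 (y₀, z), DifferentiableAt ℂ (R x.1) x.2) (l : ℕ) :
    TendstoUniformlyOn (fun y => iteratedDeriv l (R y)) (iteratedDeriv l (R y₀)) (𝓝 y₀) K := by
  obtain ⟨V, hV, hKV, hVU, hVc⟩ := exists_open_between_and_isCompact_closure hK hU hKU
  have hdiffV : ∀ᶠ y in 𝓝 y₀, DifferentiableOn ℂ (R y) V := by
    have := hVc.eventually_forall_of_forall_eventually (x₀ := y₀)
      (P := fun y z => DifferentiableAt ℂ (R y) z) fun z hz => hdiff z (hVU hz)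
    filter_upwards [this] with y hy z hz using (hy z (subset_closure hz)).differentiableWithinAt
  have hunif : TendstoLocallyUniformlyOn R (R y₀) (𝓝 y₀) V := by
    rw [hV.tendstoLocallyUniformlyOn_iff_forall_tendsto]
    intro z hz
    have hz' : ContinuousAt (Function.uncurry R) (y₀, z) := hcont z (hVU (subset_closure hz))
    have hfst : Tendsto (fun x : Y × ℂ => R y₀ x.2) (𝓝 y₀ ×ˢ 𝓝 z) (𝓝 (R y₀ z)) :=
      hz'.tendsto.comp ((tendsto_const_nhds (x := y₀)).prodMk_nhds tendsto_snd)
    rw [ContinuousAt, nhds_prod_eq] at hz'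
    exact (hfst.prodMk_nhds hz').mono_right (nhds_le_uniformity _)
  exact (tendstoLocallyUniformlyOn_iff_forall_isCompact hV).1
    (tendstoLocallyUniformlyOn_iteratedDeriv hunif hdiffV hV l) K hKV hK

theorem iteratedDeriv_polynomial_eval {𝕜 : Type*} [NontriviallyNormedField 𝕜] (P : 𝕜[X])
    (l : ℕ) :
    iteratedDeriv l (fun z => P.eval z) = fun z => (derivative^[l] P).eval z := by
  induction l with
  | zero => simp
  | succ l ih =>
    rw [iteratedDeriv_succ, ih]
    funext z
    rw [Polynomial.deriv, Function.iterate_succ_apply']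

end IteratedDeriv

section Topology

/-- The `n`-th member `{z ∈ closure Ω : |z| ≤ n}` of the compact exhaustion of `closure Ω` over
which the metric of `A^∞(Ω)` takes suprema. -/
abbrev closurePiece (Ω : Set ℂ) (n : ℕ) : Set ℂ :=
  closure Ω ∩ Metric.closedBall 0 n

theorem isCompact_closurePiece (n : ℕ) : IsCompact (closurePiece Ω n) :=
  (isCompact_closedBall 0 _).inter_left isClosed_closure

theorem closurePiece_mono {m n : ℕ} (h : m ≤ n) : closurePiece Ω m ⊆ closurePiece Ω n :=
  inter_subset_inter_right _ (Metric.closedBall_subset_closedBall (by exact_mod_cast h))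

theorem eventually_subset_closurePiece {K : Set ℂ} (hK : Bornology.IsBounded K)
    (hKΩ : K ⊆ closure Ω) : ∀ᶠ n in atTop, K ⊆ closurePiece Ω n := by
  obtain ⟨r, hr⟩ := hK.subset_closedBall 0
  filter_upwards [tendsto_natCast_atTop_atTop.eventually_ge_atTop r] with n hn
  exact subset_inter hKΩ (hr.trans (Metric.closedBall_subset_closedBall hn))

namespace AInf

theorem dist_extDeriv_lt {f g : AInf Ω} {l n : ℕ} {ε : ℝ} (hε : ε ≤ 1)
    (h : dist f g < ε / 2 ^ (l + (n + 1))) {z : ℂ} (hz : z ∈ closurePiece Ω n) :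
    dist (f.extDeriv l z) (g.extDeriv l z) < ε := by
  have hterm : 1 / 2 ^ (l + (n + 1)) * min (f.seminormDist g l (n + 1)) 1 ≤ dist f g :=
    ((f.rho_inner_summable g l).le_tsum n fun j _ => f.rho_term_nonneg g l j).trans
      ((f.rho_outer_summable g).le_tsum l fun j _ => tsum_nonneg (f.rho_term_nonneg g j))
  have hmin : min (f.seminormDist g l (n + 1)) 1 < ε := by
    have := hterm.trans_lt h
    rwa [div_mul_eq_mul_div, one_mul, div_lt_div_iff_of_pos_right (by positivity)] at this
  have hsup : f.seminormDist g l (n + 1) < ε :=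
    (min_lt_iff.1 hmin).resolve_right (not_lt.2 hε)
  rw [dist_eq_norm]
  exact (le_ciSup (f.bddAbove_seminormDist g l (n + 1))
    ⟨z, closurePiece_mono n.le_succ hz⟩).trans_lt hsup

theorem tendsto_seminormDist {ι : Type*} {φ : Filter ι} {u : ι → AInf Ω} {f : AInf Ω} {l n : ℕ}
    (h : TendstoUniformlyOn (fun i => (u i).extDeriv l) (f.extDeriv l) φ (closurePiece Ω n)) :
    Tendsto (fun i => (u i).seminormDist f l n) φ (𝓝 0) := by
  rw [Metric.tendsto_nhds]
  intro ε hε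
  filter_upwards [Metric.tendstoUniformlyOn_iff.1 h (ε / 2) (half_pos hε)] with i hi
  rw [Real.dist_0_eq_abs, abs_of_nonneg ((u i).seminormDist_nonneg f l n)]
  refine (Real.iSup_le (fun z => ?_) (half_pos hε).le).trans_lt (half_lt_self hε)
  rw [← dist_eq_norm, dist_comm]
  exact (hi z z.2).le

theorem tendsto_of_tendstoUniformlyOn {ι : Type*} {φ : Filter ι} {u : ι → AInf Ω} {f : AInf Ω}
    (h : ∀ l n : ℕ,
      TendstoUniformlyOn (fun i => (u i).extDeriv l) (f.extDeriv l) φ (closurePiece Ω n)) :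
    Tendsto u φ (𝓝 f) := by
  have hinner (l : ℕ) : Tendsto (fun i => ∑' k : ℕ, 1 / 2 ^ (l + (k + 1)) *
      min ((u i).seminormDist f l (k + 1)) 1) φ (𝓝 (∑' _ : ℕ, (0 : ℝ))) := by
    refine tendsto_tsum_of_dominated_convergence
      ((summable_geometric_two.mul_right _).mul_left _) (fun k => ?_)
      (Eventually.of_forall fun i k =>
        (Real.norm_of_nonneg ((u i).rho_term_nonneg f l k)).trans_le ((u i).rho_term_le f l k))
    simpa only [inf_of_le_left zero_le_one, mul_zero] using
      ((tendsto_seminormDist (h l (k + 1))).min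
        (tendsto_const_nhds (x := (1 : ℝ)))).const_mul (1 / 2 ^ (l + (k + 1)))
  have hsum : Summable fun l : ℕ => ∑' k : ℕ, (1 / 2 : ℝ) ^ l * ((1 / 2) ^ k * (1 / 2)) := by
    simp only [tsum_mul_left]
    exact summable_geometric_two.mul_right _
  have houter := tendsto_tsum_of_dominated_convergence hsum hinner
    (Eventually.of_forall fun i l =>
      (Real.norm_of_nonneg (tsum_nonneg ((u i).rho_term_nonneg f l))).trans_le
        (((u i).rho_inner_summable f l).tsum_le_tsum ((u i).rho_term_le f l)
          ((summable_geometric_two.mul_right _).mul_left _)))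
  rw [tendsto_iff_dist_tendsto_zero]
  simp only [tsum_zero] at houter
  exact houter

theorem tendsto_iff {ι : Type*} {φ : Filter ι} {u : ι → AInf Ω} {f : AInf Ω} :
    Tendsto u φ (𝓝 f) ↔ ∀ l n : ℕ,
      TendstoUniformlyOn (fun i => (u i).extDeriv l) (f.extDeriv l) φ (closurePiece Ω n) := by
  refine ⟨fun h l n => Metric.tendstoUniformlyOn_iff.2 fun ε hε => ?_,
    tendsto_of_tendstoUniformlyOn⟩
  have h0 : 0 < min ε 1 / 2 ^ (l + (n + 1)) := by positivity
  filter_upwards [Metric.tendsto_nhds.1 h _ h0] with i hi z hz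
  rw [dist_comm] at hi
  exact (dist_extDeriv_lt (min_le_right _ _) hi hz).trans_le (min_le_left _ _)

theorem continuous_extDeriv_apply {z : ℂ} (hz : z ∈ closure Ω) (l : ℕ) :
    Continuous fun f : AInf Ω => f.extDeriv l z := by
  obtain ⟨n, hn⟩ := (eventually_subset_closurePiece Bornology.isBounded_singleton
    (singleton_subset_iff.2 hz)).exists
  exact continuous_iff_continuousAt.2 fun f =>
    (tendsto_iff.1 tendsto_id l n).tendsto_at (singleton_subset_iff.1 hn)

theorem extDeriv_eqOn_closure (f : AInf Ω) {l : ℕ} {g : ℂ → ℂ} (hg : ContinuousOn g (closure Ω))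
    (h : EqOn (iteratedDeriv l f.toFun) g Ω) : EqOn (f.extDeriv l) g (closure Ω) :=
  ((f.extDeriv_continuousOn_eqOn l).2.trans h).of_subset_closure
    (f.extDeriv_continuousOn_eqOn l).1 hg subset_closure le_rfl

/-- The element of `A^∞(Ω)` given by the restriction to `Ω` of `h`, when the derivatives of `h`
on `Ω` extend continuously to `closure Ω` as the functions `g l`. -/
def ofEqOn (hΩ : IsOpen Ω) {h : ℂ → ℂ} (hh : DifferentiableOn ℂ h Ω) (g : ℕ → ℂ → ℂ)
    (hg : ∀ l, ContinuousOn (g l) (closure Ω)) (hgh : ∀ l, EqOn (g l) (iteratedDeriv l h) Ω) :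
    AInf Ω where
  toFun := Ω.indicator h
  zero_off _ hz := indicator_of_notMem hz h
  holomorphic := hh.congr eqOn_indicator
  extends_closure l := ⟨g l, hg l, (hgh l).trans
    ((eqOn_indicator.symm : EqOn h _ Ω).iteratedDeriv_of_isOpen hΩ l)⟩

theorem extDeriv_ofEqOn (hΩ : IsOpen Ω) {h : ℂ → ℂ} (hh : DifferentiableOn ℂ h Ω)
    {g : ℕ → ℂ → ℂ} (hg : ∀ l, ContinuousOn (g l) (closure Ω))
    (hgh : ∀ l, EqOn (g l) (iteratedDeriv l h) Ω) (l : ℕ) :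
    EqOn ((ofEqOn hΩ hh g hg hgh).extDeriv l) (g l) (closure Ω) :=
  extDeriv_eqOn_closure _ (hg l) (((eqOn_indicator (f := h)).iteratedDeriv_of_isOpen hΩ l).trans
    (hgh l).symm)

theorem exists_tendsto_of_tendstoUniformlyOn (hΩ : IsOpen Ω) {u : ℕ → AInf Ω} {g : ℕ → ℂ → ℂ}
    (h : ∀ l n : ℕ, TendstoUniformlyOn (fun m => (u m).extDeriv l) (g l) atTop
      (closurePiece Ω n)) : ∃ f, Tendsto u atTop (𝓝 f) := by
  have hcont (l : ℕ) : ContinuousOn (g l) (closure Ω) := by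
    have hloc : TendstoLocallyUniformlyOn (fun m => (u m).extDeriv l) (g l) atTop (closure Ω) := by
      intro v hv z _
      obtain ⟨n, hn⟩ := (eventually_subset_closurePiece (Ω := Ω)
        (Metric.isBounded_closedBall.subset inter_subset_right) inter_subset_left).exists
      exact ⟨closure Ω ∩ Metric.closedBall z 1, inter_mem self_mem_nhdsWithin
        (mem_nhdsWithin_of_mem_nhds (Metric.closedBall_mem_nhds z one_pos)),
        ((h l n).mono hn) v hv⟩
    exact hloc.continuousOn
      (Frequently.of_forall fun m => ((u m).extDeriv_continuousOn_eqOn l).1)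
  have hder (l : ℕ) :
      TendstoLocallyUniformlyOn (fun m => iteratedDeriv l (u m).toFun) (g l) atTop Ω := by
    refine (tendstoLocallyUniformlyOn_iff_forall_isCompact hΩ).2 fun K hKΩ hK => ?_
    obtain ⟨n, hn⟩ := (eventually_subset_closurePiece hK.isBounded
      (hKΩ.trans subset_closure)).exists
    exact ((h l n).mono hn).congr (Eventually.of_forall fun m z hz =>
      ((u m).extDeriv_continuousOn_eqOn l).2 (hKΩ hz))
  have hu : ∀ᶠ m in atTop, DifferentiableOn ℂ (u m).toFun Ω :=
    Eventually.of_forall fun m => (u m).holomorphic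
  have hder₀ : TendstoLocallyUniformlyOn (fun m => (u m).toFun) (g 0) atTop Ω := by
    simpa using hder 0
  have hiter (l : ℕ) : EqOn (g l) (iteratedDeriv l (g 0)) Ω := fun z hz =>
    tendsto_nhds_unique ((hder l).tendsto_at hz)
      ((tendstoLocallyUniformlyOn_iteratedDeriv hder₀ hu hΩ l).tendsto_at hz)
  refine ⟨ofEqOn hΩ (hder₀.differentiableOn hu hΩ) g hcont hiter,
    tendsto_of_tendstoUniformlyOn fun l n => (h l n).congr_right fun z hz => ?_⟩
  exact (extDeriv_ofEqOn hΩ _ hcont hiter l hz.1).symm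

theorem completeSpace (hΩ : IsOpen Ω) : CompleteSpace (AInf Ω) := by
  refine Metric.complete_of_cauchySeq_tendsto fun u hu => ?_
  have hunif (l n : ℕ) :
      UniformCauchySeqOn (fun m => (u m).extDeriv l) atTop (closurePiece Ω n) := by
    rw [Metric.uniformCauchySeqOn_iff]
    intro ε hε
    obtain ⟨N, hN⟩ := Metric.cauchySeq_iff.1 hu (min ε 1 / 2 ^ (l + (n + 1))) (by positivity)
    exact ⟨N, fun m hm k hk z hz =>
      (dist_extDeriv_lt (min_le_right _ _) (hN m hm k hk) hz).trans_le (min_le_left _ _)⟩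
  have hlim (l : ℕ) (z : ℂ) (hz : z ∈ closure Ω) :
      ∃ a, Tendsto (fun m => (u m).extDeriv l z) atTop (𝓝 a) := by
    obtain ⟨n, hn⟩ := (eventually_subset_closurePiece Bornology.isBounded_singleton
      (singleton_subset_iff.2 hz)).exists
    exact cauchySeq_tendsto_of_complete ((hunif l n).cauchySeq (singleton_subset_iff.1 hn))
  choose! g hg using hlim
  exact exists_tendsto_of_tendstoUniformlyOn hΩ fun l n =>
    (hunif l n).tendstoUniformlyOn_of_tendsto fun z hz => hg l z hz.1

theorem extDeriv_eqOn_iteratedDeriv (hΩ : IsOpen Ω) (f : AInf Ω) {U : Set ℂ} (hU : IsOpen U)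
    (hΩU : closure Ω ⊆ U) {h : ℂ → ℂ} (hh : DifferentiableOn ℂ h U) (hfh : EqOn f.toFun h Ω)
    (l : ℕ) : EqOn (f.extDeriv l) (iteratedDeriv l h) (closure Ω) :=
  f.extDeriv_eqOn_closure ((differentiableOn_iteratedDeriv hh hU l).continuousOn.mono hΩU)
    (hfh.iteratedDeriv_of_isOpen hΩ l)

/-- The restriction of a polynomial to `Ω`, as an element of `A^∞(Ω)`. -/
def ofPolynomial (hΩ : IsOpen Ω) (P : ℂ[X]) : AInf Ω :=
  ofEqOn hΩ P.differentiable.differentiableOn (fun l => iteratedDeriv l fun z => P.eval z)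
    (fun l => by
      rw [iteratedDeriv_polynomial_eval]; exact (derivative^[l] P).continuousOn)
    fun _ => eqOn_refl _ _

theorem extDeriv_ofPolynomial (hΩ : IsOpen Ω) (P : ℂ[X]) (l : ℕ) :
    EqOn ((ofPolynomial hΩ P).extDeriv l) (iteratedDeriv l fun z => P.eval z) (closure Ω) :=
  extDeriv_ofEqOn hΩ _ _ _ l

theorem ofPolynomial_mem_HClosure (hΩ : IsOpen Ω) (P : ℂ[X]) :
    ofPolynomial hΩ P ∈ HClosure Ω :=
  ⟨univ, fun z => P.eval z, isOpen_univ, subset_univ _, P.differentiable.differentiableOn,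
    eqOn_indicator⟩

end AInf

end Topology

section TaylorCoeff

theorem taylorCoeff_eq_extDeriv (h0 : (0 : ℂ) ∈ Ω) (f : AInf Ω) (v : ℕ) :
    taylorCoeff f.toFun v = f.extDeriv v 0 / (Nat.factorial v : ℂ) := by
  rw [taylorCoeff, (f.extDeriv_continuousOn_eqOn v).2 h0]

theorem continuous_taylorCoeff (h0 : (0 : ℂ) ∈ Ω) (v : ℕ) :
    Continuous fun f : AInf Ω => taylorCoeff f.toFun v := by
  simp only [taylorCoeff_eq_extDeriv h0]
  exact (AInf.continuous_extDeriv_apply (subset_closure h0) v).div_const _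

theorem continuous_taylorCoeffInt (h0 : (0 : ℂ) ∈ Ω) (i : ℤ) :
    Continuous fun f : AInf Ω => taylorCoeffInt f.toFun i := by
  unfold taylorCoeffInt
  split_ifs
  exacts [continuous_const, continuous_taylorCoeff h0 _]

theorem taylorCoeff_ofPolynomial (hΩ : IsOpen Ω) (h0 : (0 : ℂ) ∈ Ω) (P : ℂ[X]) (v : ℕ) :
    taylorCoeff (AInf.ofPolynomial hΩ P).toFun v = P.coeff v := by
  rw [taylorCoeff_eq_extDeriv h0, AInf.extDeriv_ofPolynomial hΩ P v (subset_closure h0),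
    congrFun (iteratedDeriv_polynomial_eval P v) 0, ← coeff_zero_eq_eval_zero,
    coeff_iterate_derivative, zero_add, Nat.descFactorial_self, nsmul_eq_mul,
    mul_div_cancel_left₀ _ (Nat.cast_ne_zero.2 v.factorial_ne_zero)]

end TaylorCoeff

section CauchyPompeiu

open MeasureTheory Complex
open scoped ComplexConjugate Real

variable {E : Type*} [NormedAddCommGroup E] [NormedSpace ℂ E]

/-- The Wirtinger derivative `∂g/∂ζ̄ = (∂g/∂x + i ∂g/∂y) / 2`. -/
def dbar (g : ℂ → E) (ζ : ℂ) : E :=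
  (1 / 2 : ℂ) • (fderiv ℝ g ζ 1 + I • fderiv ℝ g ζ I)

theorem conj_smul_dbar (g : ℂ → E) (ζ w : ℂ) :
    conj w • dbar g ζ = (1 / 2 : ℂ) • (fderiv ℝ g ζ w + I • fderiv ℝ g ζ (I * w)) := by
  have hw : w = w.re • (1 : ℂ) + w.im • I := by simp
  have hIw : I * w = w.re • I - w.im • (1 : ℂ) := by
    nth_rw 1 [hw]
    simp only [real_smul, mul_one]
    linear_combination (w.im : ℂ) * I_mul_I
  rw [hIw]
  nth_rw 1 2 [hw]
  simp only [dbar, map_add, map_sub, map_smul]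
  simp only [← Complex.coe_smul, smul_eq_mul, map_mul, conj_ofReal, map_one, conj_I]
  match_scalars
  · ring
  · linear_combination (-(w.im : ℂ) / 2) * I_mul_I

theorem dbar_eq_zero {g : ℂ → E} {ζ : ℂ} (h : DifferentiableAt ℂ g ζ) : dbar g ζ = 0 := by
  have h1 : fderiv ℝ g ζ = (fderiv ℂ g ζ).restrictScalars ℝ :=
    (h.hasFDerivAt.restrictScalars ℝ).fderiv
  have h2 : fderiv ℂ g ζ I = I • fderiv ℂ g ζ 1 := by
    rw [← map_smul, smul_eq_mul, mul_one]
  simp [dbar, h1, h2, smul_smul]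

theorem continuous_dbar {g : ℂ → E} (hg : ContDiff ℝ 1 g) : Continuous (dbar g) := by
  have := hg.continuous_fderiv one_ne_zero
  unfold dbar
  fun_prop

theorem support_dbar_subset (g : ℂ → E) : Function.support (dbar g) ⊆ tsupport g := by
  intro ζ hζ
  by_contra h
  have : fderiv ℝ g ζ = 0 := by
    by_contra h2
    exact h (support_fderiv_subset ℝ h2)
  exact hζ (by simp [dbar, this])

theorem integrableOn_fderiv_polar {g : ℂ → E} (hg : ContDiff ℝ 1 g) (hgs : HasCompactSupport g)
    (z : ℂ) {c : ℝ → ℂ} (hc : Continuous c) :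
    IntegrableOn (fun p : ℝ × ℝ => fderiv ℝ g (z + p.1 * exp (p.2 * I)) (c p.2))
      Complex.polarCoord.target := by
  obtain ⟨R, hR⟩ := hgs.isBounded.subset_closedBall z
  have hcont : Continuous fun p : ℝ × ℝ => fderiv ℝ g (z + p.1 * exp (p.2 * I)) (c p.2) :=
    ((hg.continuous_fderiv one_ne_zero).comp (by fun_prop)).clm_apply (by fun_prop)
  have hcpt : IntegrableOn (fun p : ℝ × ℝ => fderiv ℝ g (z + p.1 * exp (p.2 * I)) (c p.2))
      (Icc 0 R ×ˢ Icc (-π) π) :=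
    hcont.continuousOn.integrableOn_compact (isCompact_Icc.prod isCompact_Icc)
  refine hcpt.of_forall_sdiff_eq_zero Complex.polarCoord.open_target.measurableSet ?_
  rw [Complex.polarCoord_target]
  rintro p ⟨⟨hp0, hpπ⟩, hp⟩
  have hpR : R < p.1 := by
    by_contra! h
    exact hp ⟨⟨le_of_lt hp0, h⟩, Ioo_subset_Icc_self hpπ⟩
  have hout : z + p.1 * exp (p.2 * I) ∉ tsupport g := fun h => by
    have := hR h
    rw [mem_closedBall_iff_norm, add_sub_cancel_left, norm_mul, norm_exp_ofReal_mul_I, mul_one,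
      norm_real, Real.norm_of_nonneg (le_of_lt hp0)] at this
    exact this.not_gt hpR
  rw [Function.notMem_support.1 fun h => hout (support_fderiv_subset ℝ h),
    _root_.zero_apply]

theorem polar_smul_dbar (g : ℂ → E) (z : ℂ) {p : ℝ × ℝ} (hp : p.1 ≠ 0) :
    p.1 • ((Complex.polarCoord.symm p)⁻¹ • dbar g (z + Complex.polarCoord.symm p)) =
      (1 / 2 : ℂ) • (fderiv ℝ g (z + p.1 * exp (p.2 * I)) (exp (p.2 * I)) +
        I • fderiv ℝ g (z + p.1 * exp (p.2 * I)) (I * exp (p.2 * I))) := by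
  have hsymm : Complex.polarCoord.symm p = p.1 * exp (p.2 * I) := by
    rw [Complex.polarCoord_symm_apply, exp_mul_I, ofReal_cos, ofReal_sin]
  rw [← conj_smul_dbar, hsymm, ← inv_eq_conj (norm_exp_ofReal_mul_I _), mul_inv, ← Complex.coe_smul,
    smul_smul, mul_inv_cancel_left₀ (ofReal_ne_zero.2 hp)]

variable [CompleteSpace E] {g : ℂ → E}

theorem integral_Ioi_fderiv_ray (hg : ContDiff ℝ 1 g) (hgs : HasCompactSupport g) (z : ℂ) {w : ℂ}
    (hw : w ≠ 0) : ∫ r : ℝ in Ioi 0, fderiv ℝ g (z + r * w) w = -g z := by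
  have hγ (r : ℝ) : HasDerivAt (fun r : ℝ => z + r * w) w r := by
    simpa using ((hasDerivAt_id r).ofReal_comp.mul_const w).const_add z
  have hderiv (r : ℝ) :
      deriv (fun r : ℝ => g (z + r * w)) r = fderiv ℝ g (z + r * w) w :=
    ((hg.differentiable one_ne_zero _).hasFDerivAt.comp_hasDerivAt r (hγ r)).deriv
  have hsupp : HasCompactSupport fun r : ℝ => g (z + r * w) := by
    refine hgs.comp_isClosedEmbedding (f := g) (g := fun r : ℝ => z + r * w) ?_
    exact (Homeomorph.addLeft z).isClosedEmbedding.comp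
      ((Homeomorph.mulRight₀ w hw).isClosedEmbedding.comp isometry_ofReal.isClosedEmbedding)
  have hsmooth : ContDiff ℝ 1 fun r : ℝ => g (z + r * w) :=
    hg.comp (contDiff_const.add (ofRealCLM.contDiff.mul contDiff_const))
  simpa [hderiv] using hsupp.integral_Ioi_deriv_eq hsmooth 0

theorem integral_Ioo_fderiv_circle (hg : ContDiff ℝ 1 g) (z : ℂ) {r : ℝ} (hr : r ≠ 0) :
    ∫ θ in Ioo (-π) π, fderiv ℝ g (z + r * exp (θ * I)) (I * exp (θ * I)) = 0 := by
  have hγ (θ : ℝ) : HasDerivAt (fun θ : ℝ => z + r * exp (θ * I)) (r • (I * exp (θ * I))) θ := by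
    have := hasDerivAt_circleMap z r θ
    rwa [circleMap_zero, mul_assoc, mul_comm _ I, ← real_smul] at this
  have hderiv (θ : ℝ) (_ : θ ∈ uIcc (-π) π) :=
    (hg.differentiable one_ne_zero _).hasFDerivAt.comp_hasDerivAt θ (hγ θ)
  have hcont : Continuous fun θ : ℝ =>
      fderiv ℝ g (z + r * exp (θ * I)) (r • (I * exp (θ * I))) :=
    ((hg.continuous_fderiv one_ne_zero).comp (by fun_prop)).clm_apply (by fun_prop)
  have hftc := intervalIntegral.integral_eq_sub_of_hasDerivAt hderiv
    (hcont.intervalIntegrable _ _)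
  have hperiod : exp (((-π : ℝ) : ℂ) * I) = exp (π * I) := by
    simp [exp_neg]
  rw [intervalIntegral.integral_of_le (by linarith [Real.pi_pos]), integral_Ioc_eq_integral_Ioo]
    at hftc
  simp only [map_smul, integral_smul, Function.comp_apply, hperiod, sub_self] at hftc
  exact (smul_eq_zero.1 hftc).resolve_left hr

/-- The **Cauchy–Pompeiu formula**: in polar coordinates around `z` the integrand is
`(∂g/∂r + (i / r) ∂g/∂θ) / 2`. -/
theorem integral_inv_sub_smul_dbar (hg : ContDiff ℝ 1 g) (hgs : HasCompactSupport g) (z : ℂ) :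
    ∫ ζ, (ζ - z)⁻¹ • dbar g ζ = -(π : ℂ) • g z := by
  let A (p : ℝ × ℝ) : E := fderiv ℝ g (z + p.1 * exp (p.2 * I)) (exp (p.2 * I))
  let B (p : ℝ × ℝ) : E := fderiv ℝ g (z + p.1 * exp (p.2 * I)) (I * exp (p.2 * I))
  have hA : IntegrableOn A Complex.polarCoord.target :=
    integrableOn_fderiv_polar hg hgs z (c := fun θ => exp (θ * I)) (by fun_prop)
  have hB : IntegrableOn B Complex.polarCoord.target :=
    integrableOn_fderiv_polar hg hgs z (c := fun θ => I * exp (θ * I)) (by fun_prop)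
  have hAint : ∫ p in Complex.polarCoord.target, A p = -(2 * π : ℂ) • g z := by
    rw [Complex.polarCoord_target, Measure.volume_eq_prod, ← setIntegral_prod_swap,
      setIntegral_prod]
    · simp only [A, Prod.swap, integral_Ioi_fderiv_ray hg hgs z (exp_ne_zero _)]
      simp [← two_mul, Real.pi_nonneg, ← Complex.coe_smul]
    · rw [Complex.polarCoord_target, Measure.volume_eq_prod] at hA
      exact hA.swap
  have hBint : ∫ p in Complex.polarCoord.target, B p = 0 := by
    rw [Complex.polarCoord_target, Measure.volume_eq_prod] at hB ⊢
    rw [setIntegral_prod _ hB]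
    exact setIntegral_eq_zero_of_forall_eq_zero fun r hr =>
      integral_Ioo_fderiv_circle hg z (ne_of_gt hr)
  calc ∫ ζ, (ζ - z)⁻¹ • dbar g ζ
      = ∫ ζ, ζ⁻¹ • dbar g (z + ζ) := by
        rw [← integral_add_left_eq_self _ z]; simp
    _ = ∫ p in Complex.polarCoord.target, (1 / 2 : ℂ) • (A p + I • B p) := by
        rw [← Complex.integral_comp_polarCoord_symm]
        exact setIntegral_congr_fun Complex.polarCoord.open_target.measurableSet fun p hp =>
          polar_smul_dbar g z (ne_of_gt hp.1)
    _ = -(π : ℂ) • g z := by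
        rw [integral_smul, integral_add hA (g := fun p => I • B p) (hB.smul I), integral_smul,
          hAint, hBint, smul_zero, add_zero, smul_smul]
        ring_nf

end CauchyPompeiu

section PolynomialConvexity

variable {K T U : Set ℂ}

/-- The Banach algebra `P(K)` of uniform limits of polynomials on `K`. -/
abbrev polynomialClosure (K : Set ℂ) [CompactSpace K] : Subalgebra ℂ C(K, ℂ) :=
  (polynomialFunctions K).topologicalClosure

instance [CompactSpace K] : IsClosed (polynomialClosure K : Set C(K, ℂ)) :=
  Subalgebra.isClosed_topologicalClosure _

instance [CompactSpace K] : CompleteSpace (polynomialClosure K) :=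
  (Subalgebra.isClosed_topologicalClosure _).completeSpace_coe

/-- The coordinate function `z ↦ z` as an element of `P(K)`; it generates `P(K)`, and its spectrum
is the polynomially convex hull of `K`. -/
def coordinate (K : Set ℂ) [CompactSpace K] : polynomialClosure K :=
  ⟨X.toContinuousMapOn K,
    Subalgebra.le_topologicalClosure _ ⟨X, trivial, rfl⟩⟩

theorem aeval_coordinate_apply [CompactSpace K] (P : ℂ[X]) (z : K) :
    (aeval (coordinate K) P : C(K, ℂ)) z = P.eval (z : ℂ) := by
  let evalAt : polynomialClosure K →ₐ[ℂ] ℂ :=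
    (ContinuousMap.evalAlgHom ℂ ℂ z).comp (polynomialClosure K).val
  refine (aeval_algHom_apply evalAt (coordinate K) P).symm.trans ?_
  simp [evalAt, coordinate]

theorem exists_polynomial_dist_lt [CompactSpace K] (f : polynomialClosure K) {ε : ℝ}
    (hε : 0 < ε) : ∃ P : ℂ[X], dist f (aeval (coordinate K) P) < ε := by
  obtain ⟨g, ⟨P, -, hP⟩, hfg⟩ := Metric.mem_closure_iff.1 f.2 ε hε
  refine ⟨P, ?_⟩
  have : (aeval (coordinate K) P : C(K, ℂ)) = g := by
    ext z
    rw [aeval_coordinate_apply, ← hP]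
    simp
  rwa [Subtype.dist_eq, this]

theorem norm_le_of_mem_spectrum [CompactSpace K] {f : polynomialClosure K} {c : ℝ}
    (hf : ∀ z : K, ‖(f : C(K, ℂ)) z‖ ≤ c) {w : ℂ} (hw : w ∈ spectrum ℂ f) : ‖w‖ ≤ c := by
  rcases isEmpty_or_nonempty K with hK | hK
  · have : Subsingleton (polynomialClosure K) := ⟨fun f g => by ext z; exact hK.elim z⟩
    simp [spectrum.of_subsingleton] at hw
  · have : NormOneClass (polynomialClosure K) := ⟨norm_one (α := C(K, ℂ))⟩
    exact (spectrum.norm_le_norm_of_mem hw).trans ((ContinuousMap.norm_le_of_nonempty _).2 hf)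

/-- Polynomial convexity of a set in the plane: every point outside the set is separated from it
by a polynomial that is bounded by `1` on the set. -/
def IsPolynomiallyConvex (K : Set ℂ) : Prop :=
  ∀ a ∉ K, ∃ P : ℂ[X], (∀ z ∈ K, ‖P.eval z‖ ≤ 1) ∧ 1 < ‖P.eval a‖

theorem isPolynomiallyConvex_iff_spectrum_subset [CompactSpace K] :
    IsPolynomiallyConvex K ↔ spectrum ℂ (coordinate K) ⊆ K := by
  refine ⟨fun h a ha => ?_, fun h a ha => ?_⟩
  · by_contra haK
    obtain ⟨P, hP, hPa⟩ := h a haK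
    refine hPa.not_ge (norm_le_of_mem_spectrum (fun z => ?_)
      (spectrum.subset_polynomial_aeval (coordinate K) P (mem_image_of_mem _ ha)))
    rw [aeval_coordinate_apply]
    exact hP z z.2
  · -- A polynomial `Q` close to `1 / (a - z)` on `K` gives the separating `2 (1 - (a - z) Q(z))`.
    obtain ⟨b, hb⟩ := (spectrum.notMem_iff.1 fun h' => ha (h h')).exists_right_inv
    have hcont : Continuous fun x => 1 - (algebraMap ℂ _ a - coordinate K) * x := by fun_prop
    obtain ⟨δ, hδ, hball⟩ := Metric.continuous_iff.1 hcont b (1 / 2) one_half_pos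
    obtain ⟨Q, hQ⟩ := exists_polynomial_dist_lt b hδ
    have hnorm : ‖aeval (coordinate K) (1 - (C a - X) * Q)‖ < 1 / 2 := by
      have h' := hball (aeval (coordinate K) Q) (by rwa [dist_comm])
      rw [hb, sub_self, dist_zero_right] at h'
      rwa [map_sub, map_mul, map_sub, map_one, aeval_C, aeval_X]
    refine ⟨C 2 * (1 - (C a - X) * Q), fun z hz => ?_, by simp⟩
    have hz' := (ContinuousMap.norm_coe_le_norm
      (aeval (coordinate K) (1 - (C a - X) * Q) : C(K, ℂ)) ⟨z, hz⟩).trans hnorm.le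
    rw [aeval_coordinate_apply] at hz'
    rw [eval_mul, eval_C, norm_mul, Complex.norm_ofNat]
    linarith

theorem isPolynomiallyConvex_inter_closedBall {S : Set ℂ} (hS : IsClosed S)
    (hconn : IsConnected (((↑) : ℂ → OnePoint ℂ) '' S)ᶜ) (r : ℝ) :
    IsPolynomiallyConvex (S ∩ Metric.closedBall 0 r) := by
  have : CompactSpace ↥(S ∩ Metric.closedBall (0 : ℂ) r) :=
    isCompact_iff_compactSpace.1 ((isCompact_closedBall _ _).inter_left hS)
  rw [isPolynomiallyConvex_iff_spectrum_subset]
  set K := S ∩ Metric.closedBall (0 : ℂ) r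
  set σ := spectrum ℂ (coordinate K)
  have hσ : IsCompact σ := spectrum.isCompact _
  have hfrontier : frontier σ ⊆ K := by
    refine (Subalgebra.frontier_spectrum _ _).trans ?_
    rw [ContinuousMap.spectrum_eq_range]
    rintro _ ⟨z, rfl⟩
    simp [coordinate]
  have hopen : IsOpen (σ \ K) := by
    have : σ \ K = interior σ \ K := by
      rw [← self_sdiff_frontier, sdiff_sdiff, union_eq_right.2 hfrontier]
    rw [this]
    exact isOpen_interior.sdiff (hS.inter Metric.isClosed_closedBall)
  refine subset_inter (fun a ha => ?_) fun a ha => ?_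
  · -- Off `S`, the sets `σ` and `σᶜ ∪ {∞}` would split the connected complement of `S`.
    by_contra haS
    obtain ⟨w, -, hw, b, hb, rfl⟩ := hconn.isPreconnected
      (((↑) : ℂ → OnePoint ℂ) '' σ)ᶜ (((↑) : ℂ → OnePoint ℂ) '' (σ \ K))
      (OnePoint.isOpen_compl_image_coe.2 ⟨hσ.isClosed, hσ⟩) (OnePoint.isOpen_image_coe.2 hopen)
      (fun w hw => or_iff_not_imp_left.2 fun hwσ => by
        obtain ⟨b, hb, rfl⟩ := notMem_compl_iff.1 hwσ
        exact mem_image_of_mem _ ⟨hb, fun h => hw (mem_image_of_mem _ h.1)⟩)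
      ⟨OnePoint.infty, OnePoint.infty_notMem_image_coe, OnePoint.infty_notMem_image_coe⟩
      ⟨a, by simpa using haS, mem_image_of_mem _ ⟨ha, fun h => haS h.1⟩⟩
    exact hw (mem_image_of_mem _ hb.1)
  · refine mem_closedBall_zero_iff.2 (norm_le_of_mem_spectrum (fun z => ?_) ha)
    simpa [coordinate] using z.2.2

theorem IsPolynomiallyConvex.inter (hK : IsPolynomiallyConvex K) (hT : IsPolynomiallyConvex T) :
    IsPolynomiallyConvex (K ∩ T) := by
  intro a ha
  rcases not_and_or.1 ha with ha | ha
  · obtain ⟨P, hP, hPa⟩ := hK a ha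
    exact ⟨P, fun z hz => hP z hz.1, hPa⟩
  · obtain ⟨P, hP, hPa⟩ := hT a ha
    exact ⟨P, fun z hz => hP z hz.2, hPa⟩

theorem isPolynomiallyConvex_norm_eval_le_one (P : ℂ[X]) :
    IsPolynomiallyConvex {z | ‖P.eval z‖ ≤ 1} :=
  fun _ ha => ⟨P, fun _ hz => hz, not_le.1 ha⟩

theorem IsPolynomiallyConvex.exists_norm_eval_lt_one (hK : IsPolynomiallyConvex K) {a : ℂ}
    (ha : a ∉ K) : ∃ P : ℂ[X], (∀ z ∈ K, ‖P.eval z‖ < 1) ∧ 1 < ‖P.eval a‖ := by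
  obtain ⟨P, hP, hPa⟩ := hK a ha
  obtain ⟨c, hc1, hc⟩ := exists_between hPa
  have hc0 : 0 < c := one_pos.trans hc1
  refine ⟨Polynomial.C (c⁻¹ : ℂ) * P, fun z hz => ?_, ?_⟩ <;>
    rw [eval_mul, eval_C, norm_mul, norm_inv, Complex.norm_of_nonneg hc0.le, inv_mul_eq_div]
  · exact (div_lt_one hc0).2 ((hP z hz).trans_lt hc1)
  · exact (one_lt_div hc0).2 hc

theorem IsPolynomiallyConvex.exists_isCompact_between (hK : IsCompact K)
    (hKc : IsPolynomiallyConvex K) (hU : IsOpen U) (hKU : K ⊆ U) :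
    ∃ T, IsCompact T ∧ IsPolynomiallyConvex T ∧ K ⊆ interior T ∧ T ⊆ U := by
  obtain ⟨r, hr, hKr⟩ := hK.isBounded.subset_ball_lt 0 0
  have hclosed (P : ℂ[X]) : IsClosed {z | ‖P.eval z‖ ≤ 1} :=
    isClosed_le P.continuous.norm continuous_const
  have hsub {P : ℂ[X]} (hP : ∀ z ∈ K, ‖P.eval z‖ < 1) : K ⊆ interior {z | ‖P.eval z‖ ≤ 1} :=
    fun z hz => mem_interior.2 ⟨_, fun _ hw => le_of_lt hw,
      isOpen_lt P.continuous.norm continuous_const, hP z hz⟩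
  obtain ⟨T, hT, hTc, hKT, hTd⟩ : ∃ T, IsClosed T ∧ IsPolynomiallyConvex T ∧ K ⊆ interior T ∧
      Disjoint T (Metric.closedBall 0 r \ U) := by
    refine ((isCompact_closedBall 0 r).diff hU).induction_on ?_ ?_ ?_ ?_
    · exact ⟨univ, isClosed_univ, fun a ha => (ha trivial).elim, by simp, disjoint_empty _⟩
    · rintro s t hst ⟨T, hT, hTc, hKT, hTt⟩
      exact ⟨T, hT, hTc, hKT, hTt.mono_right hst⟩
    · rintro s t ⟨T₁, hT₁, hTc₁, hKT₁, hTs⟩ ⟨T₂, hT₂, hTc₂, hKT₂, hTt⟩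
      exact ⟨T₁ ∩ T₂, hT₁.inter hT₂, hTc₁.inter hTc₂,
        by rw [interior_inter]; exact subset_inter hKT₁ hKT₂,
        disjoint_union_right.2 ⟨hTs.mono_left inter_subset_left,
          hTt.mono_left inter_subset_right⟩⟩
    · intro a ha
      obtain ⟨P, hP, hPa⟩ := hKc.exists_norm_eval_lt_one fun haK => ha.2 (hKU haK)
      refine ⟨{z | 1 < ‖P.eval z‖}, mem_nhdsWithin_of_mem_nhds
        ((isOpen_lt continuous_const P.continuous.norm).mem_nhds hPa), _, hclosed P,
        isPolynomiallyConvex_norm_eval_le_one P, hsub hP, ?_⟩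
      exact disjoint_left.2 fun z (hz : ‖P.eval z‖ ≤ 1) (hz' : 1 < ‖P.eval z‖) => hz.not_gt hz'
  have hball : Metric.closedBall (0 : ℂ) r = {z | ‖(C (r⁻¹ : ℂ) * X).eval z‖ ≤ 1} := by
    ext z
    simp [abs_of_pos hr, inv_mul_le_one₀ hr]
  refine ⟨T ∩ Metric.closedBall 0 r, (isCompact_closedBall 0 r).inter_left hT,
    hTc.inter (hball ▸ isPolynomiallyConvex_norm_eval_le_one _), ?_, fun z hz => ?_⟩
  · rw [interior_inter]
    exact subset_inter hKT (hKr.trans Metric.ball_subset_interior_closedBall)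
  · by_contra hzU
    exact disjoint_left.1 hTd hz.1 ⟨hz.2, hzU⟩

end PolynomialConvexity

section Runge

open MeasureTheory

variable {K T U V : Set ℂ} {f g : ℂ → ℂ}

theorem IsPolynomiallyConvex.exists_eq_inv_sub [CompactSpace T] (hT : IsPolynomiallyConvex T)
    {a : ℂ} (ha : a ∉ T) : ∃ b : polynomialClosure T, ∀ z : T, (b : C(T, ℂ)) z = (a - z)⁻¹ := by
  obtain ⟨b, hb⟩ := (spectrum.notMem_iff.1 fun h =>
    ha (isPolynomiallyConvex_iff_spectrum_subset.1 hT h)).exists_right_inv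
  refine ⟨b, fun z => eq_inv_of_mul_eq_one_right ?_⟩
  simpa [coordinate] using congrArg (fun x : polynomialClosure T => (x : C(T, ℂ)) z) hb

open scoped Manifold in
theorem exists_contDiff_cutoff (hK : IsCompact K) (hU : IsOpen U) (hKU : K ⊆ U)
    (hf : DifferentiableOn ℂ f U) :
    ∃ (g : ℂ → ℂ) (V : Set ℂ), ContDiff ℝ 1 g ∧ HasCompactSupport g ∧ IsOpen V ∧ K ⊆ V ∧ V ⊆ U ∧
      EqOn g f V := by
  obtain ⟨T, hT, hKT, hTU⟩ := exists_compact_between hK hU hKU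
  obtain ⟨χ, h1, h0, -⟩ := exists_contMDiffMap_one_nhds_of_subset_interior (n := 1) 𝓘(ℝ, ℂ)
    hK.isClosed hKT
  have hχ : ContDiff ℝ 1 χ := χ.contMDiff.contDiff
  obtain ⟨V, hV, hKV, hV1⟩ := eventually_nhdsSet_iff_exists.1 h1
  refine ⟨fun ζ => χ ζ • f ζ, V ∩ U, ?_, ?_, hV.inter hU, subset_inter hKV hKU,
    inter_subset_right, fun ζ hζ => by simp [hV1 ζ hζ.1]⟩
  · rw [contDiff_iff_contDiffAt]
    intro ζ
    by_cases hζ : ζ ∈ T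
    · have hfζ : ContDiffAt ℂ 1 f ζ := (hf.analyticAt (hU.mem_nhds (hTU hζ))).contDiffAt
      exact hχ.contDiffAt.smul (hfζ.restrict_scalars ℝ)
    · refine (contDiffAt_const (c := (0 : ℂ))).congr_of_eventuallyEq ?_
      filter_upwards [hT.isClosed.isOpen_compl.mem_nhds hζ] with w hw
      rw [h0 w hw, zero_smul]
  · exact HasCompactSupport.intro hT fun ζ hζ => by rw [h0 ζ hζ, zero_smul]

theorem continuous_cauchyKernel_smul_dbar (hg : ContDiff ℝ 1 g) (hV : IsOpen V) (hTV : T ⊆ V)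
    (hgV : DifferentiableOn ℂ g V) :
    Continuous fun q : ℂ × T => (q.1 - q.2)⁻¹ • dbar g q.1 := by
  refine continuous_iff_continuousAt.2 fun q => ?_
  by_cases hq : q.1 ∈ V
  · refine (continuousAt_const (y := (0 : ℂ))).congr ?_
    filter_upwards [continuous_fst.continuousAt.preimage_mem_nhds (hV.mem_nhds hq)] with q' hq'
    rw [dbar_eq_zero (hgV.differentiableAt (hV.mem_nhds hq')), smul_zero]
  · have hne : q.1 - q.2 ≠ 0 := sub_ne_zero.2 fun h => hq (h ▸ hTV q.2.2)
    have := (continuous_dbar hg).continuousAt (x := q.1)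
    fun_prop (disch := exact hne)

/-- By the Cauchy–Pompeiu formula `g` is a superposition of Cauchy kernels with poles off `T`. -/
theorem exists_polynomialClosure_eq_of_hasCompactSupport [CompactSpace T]
    (hT : IsPolynomiallyConvex T) (hg : ContDiff ℝ 1 g) (hgs : HasCompactSupport g)
    (hV : IsOpen V) (hTV : T ⊆ V) (hgV : DifferentiableOn ℂ g V) :
    ∃ h : polynomialClosure T, ∀ z : T, (h : C(T, ℂ)) z = g z := by
  let J : C(ℂ × T, ℂ) := ⟨_, continuous_cauchyKernel_smul_dbar hg hV hTV hgV⟩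
  have hJ (ζ : ℂ) (z : T) : J.curry ζ z = (ζ - z)⁻¹ • dbar g ζ := rfl
  have hmem (ζ : ℂ) : J.curry ζ ∈ polynomialClosure T := by
    by_cases hζ : ζ ∈ T
    · have : J.curry ζ = 0 := by
        ext z
        rw [hJ, dbar_eq_zero (hgV.differentiableAt (hV.mem_nhds (hTV hζ))), smul_zero,
          ContinuousMap.zero_apply]
      exact this ▸ zero_mem _
    · obtain ⟨b, hb⟩ := hT.exists_eq_inv_sub hζ
      have : J.curry ζ = dbar g ζ • (b : C(T, ℂ)) := by
        ext z
        rw [hJ, ContinuousMap.smul_apply, hb, smul_eq_mul, smul_eq_mul, mul_comm]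
      exact this ▸ Subalgebra.smul_mem _ b.2 _
  let G (ζ : ℂ) : polynomialClosure T := ⟨J.curry ζ, hmem ζ⟩
  have hG : Continuous G := J.curry.continuous.subtype_mk _
  have hGs : HasCompactSupport G := hgs.mono' <| Function.support_subset_iff'.2 fun ζ hζ => by
    ext z
    have hdbar : dbar g ζ = 0 := by
      by_contra h
      exact hζ (support_dbar_subset g h)
    change J.curry ζ z = 0
    rw [hJ, hdbar, smul_zero]
  refine ⟨-(Real.pi : ℂ)⁻¹ • ∫ ζ, G ζ, fun z => ?_⟩
  let evalAt : polynomialClosure T →L[ℂ] ℂ :=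
    (ContinuousMap.evalCLM ℂ z).comp (Subalgebra.toSubmodule (polynomialClosure T)).subtypeL
  have heval : evalAt (∫ ζ, G ζ) = -(Real.pi : ℂ) • g z :=
    (evalAt.integral_comp_comm (hG.integrable_of_hasCompactSupport hGs)).symm.trans
      (integral_inv_sub_smul_dbar hg hgs z)
  change evalAt (-(Real.pi : ℂ)⁻¹ • ∫ ζ, G ζ) = g z
  rw [map_smul, heval]
  simp [Real.pi_ne_zero]

theorem IsPolynomiallyConvex.exists_tendstoUniformlyOn_eval (hT : IsCompact T)
    (hTc : IsPolynomiallyConvex T) (hU : IsOpen U) (hTU : T ⊆ U) (hf : DifferentiableOn ℂ f U) :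
    ∃ P : ℕ → ℂ[X], TendstoUniformlyOn (fun n z => (P n).eval z) f atTop T := by
  have : CompactSpace T := isCompact_iff_compactSpace.1 hT
  obtain ⟨g, V, hg, hgs, hV, hTV, hVU, hgf⟩ := exists_contDiff_cutoff hT hU hTU hf
  obtain ⟨h, hh⟩ := exists_polynomialClosure_eq_of_hasCompactSupport hTc hg hgs hV hTV
    ((hf.mono hVU).congr hgf)
  choose P hP using fun n : ℕ =>
    exists_polynomial_dist_lt h (Nat.one_div_pos_of_nat (α := ℝ) (n := n))
  refine ⟨P, Metric.tendstoUniformlyOn_iff.2 fun ε hε => ?_⟩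
  filter_upwards [tendsto_one_div_add_atTop_nhds_zero_nat.eventually_lt_const hε] with n hn z hz
  rw [← hgf (hTV hz), ← hh ⟨z, hz⟩, ← aeval_coordinate_apply (P n) ⟨z, hz⟩]
  exact (ContinuousMap.dist_apply_le_dist _).trans_lt ((hP n).trans hn)

theorem IsPolynomiallyConvex.exists_tendstoUniformlyOn_iteratedDeriv (hK : IsCompact K)
    (hKc : IsPolynomiallyConvex K) (hU : IsOpen U) (hKU : K ⊆ U) (hf : DifferentiableOn ℂ f U) :
    ∃ P : ℕ → ℂ[X], ∀ l, TendstoUniformlyOn (fun n => iteratedDeriv l fun z => (P n).eval z)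
      (iteratedDeriv l f) atTop K := by
  obtain ⟨T, hT, hTc, hKT, hTU⟩ := hKc.exists_isCompact_between hK hU hKU
  obtain ⟨P, hP⟩ := hTc.exists_tendstoUniformlyOn_eval hT hU hTU hf
  refine ⟨P, fun l => ?_⟩
  have hP' := (hP.mono interior_subset).tendstoLocallyUniformlyOn
  exact (tendstoLocallyUniformlyOn_iff_forall_isCompact isOpen_interior).1
    (tendstoLocallyUniformlyOn_iteratedDeriv hP'
      (.of_forall fun n => (P n).differentiable.differentiableOn) isOpen_interior l) K hKT hK

theorem HClosure_subset_closure_range_ofPolynomial (hΩ : IsOpen Ω)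
    (hconn : IsConnected (((↑) : ℂ → OnePoint ℂ) '' closure Ω)ᶜ) :
    HClosure Ω ⊆ closure (range (AInf.ofPolynomial hΩ)) := by
  rintro f ⟨U, h, hU, hΩU, hh, hfh⟩
  have hrunge (n : ℕ) : ∃ P : ℂ[X], ∀ l ≤ n, ∀ z ∈ closurePiece Ω n,
      dist (f.extDeriv l z) ((AInf.ofPolynomial hΩ P).extDeriv l z) < 1 / (n + 1) := by
    have hpc : IsPolynomiallyConvex (closurePiece Ω n) :=
      isPolynomiallyConvex_inter_closedBall isClosed_closure hconn n
    obtain ⟨Q, hQ⟩ := hpc.exists_tendstoUniformlyOn_iteratedDeriv (isCompact_closurePiece n) hU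
      (inter_subset_left.trans hΩU) hh
    obtain ⟨m, hm⟩ := ((finite_Iic n).eventually_all.2 fun l _ =>
      Metric.tendstoUniformlyOn_iff.1 (hQ l) _ (Nat.one_div_pos_of_nat (n := n))).exists
    refine ⟨Q m, fun l hl z hz => ?_⟩
    rw [f.extDeriv_eqOn_iteratedDeriv hΩ hU hΩU hh hfh l hz.1,
      AInf.extDeriv_ofPolynomial hΩ (Q m) l hz.1]
    exact hm l hl z hz
  choose P hP using hrunge
  refine mem_closure_of_tendsto (f := fun n => AInf.ofPolynomial hΩ (P n)) (b := atTop)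
    (AInf.tendsto_iff.2 fun l n => Metric.tendstoUniformlyOn_iff.2 fun ε hε => ?_)
    (.of_forall fun n => mem_range_self _)
  filter_upwards [eventually_ge_atTop l, eventually_ge_atTop n,
    tendsto_one_div_add_atTop_nhds_zero_nat.eventually_lt_const hε] with m hlm hnm hm z hz
  exact (hP m l hlm z (closurePiece_mono hnm hz)).trans hm

end Runge

section Pade

open Matrix

variable {f : ℂ → ℂ} {p q : ℕ}

/-- The Taylor series of `f` at `0`, as a formal power series. -/
def taylorSeries (f : ℂ → ℂ) : PowerSeries ℂ := PowerSeries.mk (taylorCoeff f)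

theorem coeff_monomial_mul_taylorSeries (f : ℂ → ℂ) (j : ℕ) (c : ℂ) (v : ℕ) :
    PowerSeries.coeff v (((monomial j c : ℂ[X]) : PowerSeries ℂ) * taylorSeries f) =
      c * taylorCoeffInt f ((v : ℤ) - j) := by
  rw [← C_mul_X_pow_eq_monomial, Polynomial.coe_mul, Polynomial.coe_C, Polynomial.coe_pow,
    Polynomial.coe_X, mul_assoc, PowerSeries.coeff_C_mul, PowerSeries.coeff_X_pow_mul']
  congr 1
  rcases le_or_gt j v with h | h
  · rw [if_pos h, taylorCoeffInt, if_neg (by lia), taylorSeries, PowerSeries.coeff_mk,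
      ← Nat.cast_sub h, Int.toNat_natCast]
  · rw [if_neg h.not_ge, taylorCoeffInt, if_pos (by lia)]

theorem coeff_mul_inv_eq_iff {D : ℂ[X]} (hD : D.coeff 0 ≠ 0) (N : ℂ[X]) (n : ℕ) :
    (∀ v ≤ n, PowerSeries.coeff v ((N : PowerSeries ℂ) * (D : PowerSeries ℂ)⁻¹) =
      taylorCoeff f v) ↔
    ∀ v ≤ n, N.coeff v = PowerSeries.coeff v ((D : PowerSeries ℂ) * taylorSeries f) := by
  have hDinv : (D : PowerSeries ℂ) * (D : PowerSeries ℂ)⁻¹ = 1 :=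
    PowerSeries.mul_inv_cancel _ (by rwa [Polynomial.constantCoeff_coe])
  have hdvd : PowerSeries.X ^ (n + 1) ∣
        (N : PowerSeries ℂ) * (D : PowerSeries ℂ)⁻¹ - taylorSeries f ↔
      PowerSeries.X ^ (n + 1) ∣ (N : PowerSeries ℂ) - (D : PowerSeries ℂ) * taylorSeries f := by
    rw [← (IsUnit.of_mul_eq_one _ hDinv).dvd_mul_left]
    congr! 1
    linear_combination (N : PowerSeries ℂ) * hDinv
  simpa only [PowerSeries.X_pow_dvd_iff, map_sub, sub_eq_zero, Nat.lt_succ_iff, taylorSeries,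
    PowerSeries.coeff_mk, Polynomial.coeff_coe] using hdvd

/-- The matrix of the linear system for the coefficients of the Padé denominator. Reversing its
columns gives the Hankel matrix that defines `D_{p,q}`. -/
def toeplitz (f : ℂ → ℂ) (p q : ℕ) : Matrix (Fin q) (Fin q) ℂ :=
  of fun i j => taylorCoeffInt f ((p : ℤ) + (i : ℕ) - (j : ℕ))

theorem inD_iff_det_toeplitz_ne_zero : InD f p q ↔ (toeplitz f p q).det ≠ 0 := by
  have hreverse : (of fun i j : Fin q =>
      taylorCoeffInt f ((p : ℤ) - (q : ℤ) + 1 + (i : ℕ) + (j : ℕ))) =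
      (toeplitz f p q).submatrix id Fin.revPerm := by
    ext i j
    simp only [toeplitz, of_apply, submatrix_apply, id, Fin.revPerm_apply, Fin.val_rev]
    congr 1
    have := j.isLt
    omega
  rw [InD, hreverse, det_permute', Ne, mul_eq_zero, not_or]
  exact and_iff_right (by exact_mod_cast (Equiv.Perm.sign _).ne_zero)

theorem coeff_one_add_X_mul_ofFn_mul_taylorSeries (c : Fin q → ℂ) (i : Fin q) :
    PowerSeries.coeff (p + i + 1)
        (((1 + X * ofFn q c : ℂ[X]) : PowerSeries ℂ) * taylorSeries f) =
      taylorCoeff f (p + i + 1) + (toeplitz f p q *ᵥ c) i := by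
  have hofFn : PowerSeries.coeff (p + i) ((ofFn q c : PowerSeries ℂ) * taylorSeries f) =
      (toeplitz f p q *ᵥ c) i := by
    rw [ofFn_eq_sum_monomial, ← Polynomial.coeToPowerSeries.ringHom_apply, map_sum,
      Finset.sum_mul, map_sum, mulVec, dotProduct]
    refine Finset.sum_congr rfl fun j _ => ?_
    rw [Polynomial.coeToPowerSeries.ringHom_apply, coeff_monomial_mul_taylorSeries, toeplitz,
      of_apply, mul_comm, Nat.cast_add]
  rw [Polynomial.coe_add, Polynomial.coe_one, Polynomial.coe_mul, Polynomial.coe_X, add_mul,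
    one_mul, mul_assoc, map_add, PowerSeries.coeff_succ_X_mul, hofFn, taylorSeries,
    PowerSeries.coeff_mk]

theorem natDegree_le_and_coeff_zero_eq_one_iff {D : ℂ[X]} :
    D.natDegree ≤ q ∧ D.coeff 0 = 1 ↔ ∃ c : Fin q → ℂ, D = 1 + X * ofFn q c := by
  constructor
  · rintro ⟨hq, h0⟩
    refine ⟨fun j => D.coeff (j + 1), Polynomial.ext fun i => ?_⟩
    rcases i with _ | i
    · simpa using h0
    · rw [coeff_add, coeff_X_mul, coeff_one, if_neg i.succ_ne_zero, zero_add]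
      rcases lt_or_ge i q with hi | hi
      · rw [ofFn_coeff_eq_val_of_lt _ hi]
      · rw [ofFn_coeff_eq_zero_of_ge _ hi, coeff_eq_zero_of_natDegree_lt (by lia)]
  · rintro ⟨c, rfl⟩
    refine ⟨natDegree_le_iff_coeff_eq_zero.2 fun i hi => ?_, by simp⟩
    obtain ⟨i, rfl⟩ := Nat.exists_eq_succ_of_ne_zero (Nat.ne_zero_of_lt hi)
    rw [coeff_add, coeff_X_mul, coeff_one, if_neg i.succ_ne_zero, zero_add,
      ofFn_coeff_eq_zero_of_ge _ (Nat.lt_succ_iff.1 hi)]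

theorem natDegree_le_and_forall_coeff_eq_iff {N : ℂ[X]} {S : PowerSeries ℂ} :
    (N.natDegree ≤ p ∧ ∀ v ≤ p + q, N.coeff v = PowerSeries.coeff v S) ↔
      N = S.trunc (p + 1) ∧ ∀ i : Fin q, PowerSeries.coeff (p + i + 1) S = 0 := by
  constructor
  · rintro ⟨hN, h⟩
    refine ⟨Polynomial.ext fun v => ?_, fun i => ?_⟩
    · rw [PowerSeries.coeff_trunc]
      split_ifs with hv
      · exact h v (by lia)
      · exact coeff_eq_zero_of_natDegree_lt (by lia)
    · rw [← h _ (by lia), coeff_eq_zero_of_natDegree_lt (by lia)]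
  · rintro ⟨rfl, h⟩
    refine ⟨Nat.lt_succ_iff.1 (PowerSeries.natDegree_trunc_lt S p), fun v hv => ?_⟩
    rw [PowerSeries.coeff_trunc]
    split_ifs with hvp
    · rfl
    · obtain ⟨i, rfl⟩ := Nat.exists_eq_add_of_le (not_lt.1 hvp)
      rw [add_right_comm, h ⟨i, by lia⟩]

theorem isPade_iff_exists {N D : ℂ[X]} :
    IsPade f p q N D ↔ ∃ c : Fin q → ℂ, D = 1 + X * ofFn q c ∧
      N = ((D : PowerSeries ℂ) * taylorSeries f).trunc (p + 1) ∧
      toeplitz f p q *ᵥ c = fun i : Fin q => -taylorCoeff f (p + i + 1) := by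
  have hden : IsPade f p q N D ↔ (D.natDegree ≤ q ∧ D.coeff 0 = 1) ∧ N.natDegree ≤ p ∧
      ∀ v ≤ p + q, N.coeff v = PowerSeries.coeff v ((D : PowerSeries ℂ) * taylorSeries f) :=
    ⟨fun h => ⟨⟨h.2, h.3⟩, h.1, (coeff_mul_inv_eq_iff (h.3 ▸ one_ne_zero) N _).1 h.4⟩,
      fun h => ⟨h.2.1, h.1.1, h.1.2,
        (coeff_mul_inv_eq_iff (h.1.2 ▸ one_ne_zero) N _).2 h.2.2⟩⟩
  rw [hden, natDegree_le_and_coeff_zero_eq_one_iff, natDegree_le_and_forall_coeff_eq_iff,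
    ← exists_and_right]
  refine exists_congr fun c => and_congr_right ?_
  rintro rfl
  simp only [coeff_one_add_X_mul_ofFn_mul_taylorSeries, funext_iff,
    add_eq_zero_iff_eq_neg']

/-- The denominator of the Padé approximant `[p/q]_f`, for `f ∈ D_{p,q}`. -/
def padeDen (f : ℂ → ℂ) (p q : ℕ) : ℂ[X] :=
  1 + X * ofFn q ((toeplitz f p q)⁻¹ *ᵥ fun i : Fin q => -taylorCoeff f (p + i + 1))

theorem natDegree_padeDen_le (f : ℂ → ℂ) : (padeDen f p q).natDegree ≤ q :=
  (natDegree_le_and_coeff_zero_eq_one_iff.2 ⟨_, rfl⟩).1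

/-- The numerator of the Padé approximant `[p/q]_f`, for `f ∈ D_{p,q}`. -/
def padeNum (f : ℂ → ℂ) (p q : ℕ) : ℂ[X] :=
  ((padeDen f p q : PowerSeries ℂ) * taylorSeries f).trunc (p + 1)

theorem isPade_iff (h : InD f p q) {N D : ℂ[X]} :
    IsPade f p q N D ↔ N = padeNum f p q ∧ D = padeDen f p q := by
  have hdet : IsUnit (toeplitz f p q).det := (inD_iff_det_toeplitz_ne_zero.1 h).isUnit
  have hsolve (c b : Fin q → ℂ) : toeplitz f p q *ᵥ c = b ↔ c = (toeplitz f p q)⁻¹ *ᵥ b := by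
    constructor
    · rintro rfl
      rw [mulVec_mulVec, nonsing_inv_mul _ hdet, one_mulVec]
    · rintro rfl
      rw [mulVec_mulVec, mul_nonsing_inv _ hdet, one_mulVec]
  simp only [isPade_iff_exists, hsolve]
  constructor
  · rintro ⟨c, rfl, rfl, rfl⟩
    exact ⟨rfl, rfl⟩
  · rintro ⟨rfl, rfl⟩
    exact ⟨_, rfl, rfl, rfl⟩

theorem isPade_of_taylorCoeff_eq {P : ℂ[X]} (hf : ∀ v, taylorCoeff f v = P.coeff v) (q : ℕ) :
    IsPade f P.natDegree q P 1 := by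
  refine ⟨le_rfl, by simp, by simp, (coeff_mul_inv_eq_iff (by simp) P _).2 fun v _ => ?_⟩
  rw [Polynomial.coe_one, one_mul, taylorSeries, PowerSeries.coeff_mk, hf]

theorem inD_of_taylorCoeff_eq {P : ℂ[X]} (hP : P ≠ 0) (hf : ∀ v, taylorCoeff f v = P.coeff v)
    (q : ℕ) : InD f P.natDegree q := by
  rw [inD_iff_det_toeplitz_ne_zero, det_of_isUpperTriangular]
  · refine Finset.prod_ne_zero_iff.2 fun i _ => ?_
    rw [toeplitz, of_apply, add_sub_cancel_right, taylorCoeffInt, if_neg (by lia),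
      Int.toNat_natCast, hf, coeff_natDegree]
    exact leadingCoeff_ne_zero.2 hP
  · intro i j hij
    have hij : (j : ℕ) < i := hij
    rw [toeplitz, of_apply, taylorCoeffInt, if_neg (by lia), hf]
    exact coeff_eq_zero_of_natDegree_lt (by lia)

end Pade

section PadeContinuity

open Matrix

variable {p q : ℕ}

theorem continuous_toeplitz (h0 : (0 : ℂ) ∈ Ω) (p q : ℕ) :
    Continuous fun f : AInf Ω => toeplitz f.toFun p q :=
  continuous_matrix fun _ _ => continuous_taylorCoeffInt h0 _

theorem isOpen_inD (h0 : (0 : ℂ) ∈ Ω) (p q : ℕ) : IsOpen {f : AInf Ω | InD f.toFun p q} := by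
  simp only [inD_iff_det_toeplitz_ne_zero]
  exact isOpen_ne_fun (continuous_toeplitz h0 p q).matrix_det continuous_const

theorem continuousAt_coeff_padeDen (h0 : (0 : ℂ) ∈ Ω) {f : AInf Ω} (hf : InD f.toFun p q)
    (i : ℕ) : ContinuousAt (fun g : AInf Ω => (padeDen g.toFun p q).coeff i) f := by
  have hinv : ContinuousAt (fun g : AInf Ω => (toeplitz g.toFun p q)⁻¹) f :=
    (continuousAt_matrix_inv _ (by
      rw [Ring.inverse_eq_inv']
      exact continuousAt_inv₀ (inD_iff_det_toeplitz_ne_zero.1 hf))).comp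
      (continuous_toeplitz h0 p q).continuousAt
  have hsol : ContinuousAt (fun g : AInf Ω => (toeplitz g.toFun p q)⁻¹ *ᵥ
      fun i : Fin q => -taylorCoeff g.toFun (p + i + 1)) f := by
    have : Continuous fun x : Matrix (Fin q) (Fin q) ℂ × (Fin q → ℂ) => x.1 *ᵥ x.2 := by fun_prop
    refine this.continuousAt.comp₂ hinv ?_
    exact (continuous_pi fun i => (continuous_taylorCoeff h0 _).neg).continuousAt
  rcases i with _ | i
  · simp [padeDen, continuousAt_const]
  · simp only [padeDen, coeff_add, coeff_X_mul]
    refine continuousAt_const.add ?_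
    rcases lt_or_ge i q with hi | hi
    · simp only [ofFn_coeff_eq_val_of_lt _ hi]
      exact (continuousAt_apply _ _).comp hsol
    · simp only [ofFn_coeff_eq_zero_of_ge _ hi]
      exact continuousAt_const

theorem continuousAt_coeff_padeNum (h0 : (0 : ℂ) ∈ Ω) {f : AInf Ω} (hf : InD f.toFun p q)
    (i : ℕ) : ContinuousAt (fun g : AInf Ω => (padeNum g.toFun p q).coeff i) f := by
  simp only [padeNum, PowerSeries.coeff_trunc]
  split_ifs
  · simp only [PowerSeries.coeff_mul, Polynomial.coeff_coe, taylorSeries, PowerSeries.coeff_mk]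
    exact tendsto_finsetSum _ fun x _ => (continuousAt_coeff_padeDen h0 hf x.1).mul
      (continuous_taylorCoeff h0 x.2).continuousAt
  · exact continuousAt_const

theorem continuousAt_uncurry_eval {Y : Type*} [TopologicalSpace Y] {P : Y → ℂ[X]} {n : ℕ}
    (hdeg : ∀ y, (P y).natDegree ≤ n) {y₀ : Y}
    (hcoeff : ∀ i, ContinuousAt (fun y => (P y).coeff i) y₀) (z : ℂ) :
    ContinuousAt (Function.uncurry fun y w => (P y).eval w) (y₀, z) := by
  have heval : (Function.uncurry fun y w => (P y).eval w) =
      fun x : Y × ℂ => ∑ i ∈ Finset.range (n + 1), (P x.1).coeff i * x.2 ^ i :=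
    funext fun x => eval_eq_sum_range' (Nat.lt_succ_iff.2 (hdeg x.1)) x.2
  rw [heval]
  exact tendsto_finsetSum _ fun i _ => (hcoeff i).fst'.fun_mul (continuousAt_snd.fun_pow i)

theorem continuousAt_uncurry_eval_padeDen (h0 : (0 : ℂ) ∈ Ω) {f : AInf Ω}
    (hf : InD f.toFun p q) (z : ℂ) :
    ContinuousAt (Function.uncurry fun (g : AInf Ω) w => (padeDen g.toFun p q).eval w) (f, z) :=
  continuousAt_uncurry_eval (fun _ => natDegree_padeDen_le _) (continuousAt_coeff_padeDen h0 hf) z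

theorem continuousAt_uncurry_eval_padeNum (h0 : (0 : ℂ) ∈ Ω) {f : AInf Ω}
    (hf : InD f.toFun p q) (z : ℂ) :
    ContinuousAt (Function.uncurry fun (g : AInf Ω) w => (padeNum g.toFun p q).eval w) (f, z) :=
  continuousAt_uncurry_eval
    (fun _ => Nat.lt_succ_iff.1 (PowerSeries.natDegree_trunc_lt _ _))
    (continuousAt_coeff_padeNum h0 hf) z

theorem eventually_eval_padeDen_ne_zero (h0 : (0 : ℂ) ∈ Ω) {f : AInf Ω}
    (hf : InD f.toFun p q) {z : ℂ} (hz : (padeDen f.toFun p q).eval z ≠ 0) :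
    ∀ᶠ x : AInf Ω × ℂ in 𝓝 (f, z), (padeDen x.1.toFun p q).eval x.2 ≠ 0 :=
  (continuousAt_uncurry_eval_padeDen h0 hf z).eventually_ne hz

/-- The Padé approximant `[p/q]_f` as a function, for `f ∈ D_{p,q}`; it takes the value `0` at its
poles. -/
def padeQuot (f : ℂ → ℂ) (p q : ℕ) (z : ℂ) : ℂ :=
  (padeNum f p q).eval z / (padeDen f p q).eval z

theorem differentiableAt_padeQuot {f : ℂ → ℂ} {z : ℂ} (hz : (padeDen f p q).eval z ≠ 0) :
    DifferentiableAt ℂ (padeQuot f p q) z :=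
  (padeNum f p q).differentiableAt.div (padeDen f p q).differentiableAt hz

theorem continuousOn_iteratedDeriv_padeQuot {f : ℂ → ℂ} {K : Set ℂ}
    (hK : ∀ z ∈ K, (padeDen f p q).eval z ≠ 0) (l : ℕ) :
    ContinuousOn (iteratedDeriv l (padeQuot f p q)) K := by
  have hdiff : DifferentiableOn ℂ (padeQuot f p q) {z | (padeDen f p q).eval z ≠ 0} :=
    fun z hz => (differentiableAt_padeQuot hz).differentiableWithinAt
  exact (differentiableOn_iteratedDeriv hdiff
    (isOpen_ne_fun (padeDen f p q).continuous continuous_const) l).continuousOn.mono hK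

theorem tendstoUniformlyOn_iteratedDeriv_padeQuot (h0 : (0 : ℂ) ∈ Ω) {f : AInf Ω}
    (hf : InD f.toFun p q) {K : Set ℂ} (hK : IsCompact K)
    (hpole : ∀ z ∈ K, (padeDen f.toFun p q).eval z ≠ 0) (l : ℕ) :
    TendstoUniformlyOn (fun g : AInf Ω => iteratedDeriv l (padeQuot g.toFun p q))
      (iteratedDeriv l (padeQuot f.toFun p q)) (𝓝 f) K := by
  refine tendstoUniformlyOn_iteratedDeriv_of_continuousAt
    (R := fun g : AInf Ω => padeQuot g.toFun p q)
    (isOpen_ne_fun (padeDen f.toFun p q).continuous continuous_const) hK hpole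
    (fun z hz => ?_) (fun z hz => ?_) l
  · exact (continuousAt_uncurry_eval_padeNum h0 hf z).div
      (continuousAt_uncurry_eval_padeDen h0 hf z) hz
  · filter_upwards [eventually_eval_padeDen_ne_zero h0 hf hz] with x hx
    exact differentiableAt_padeQuot hx

end PadeContinuity

section GoodSets

/-- The functions in `D_{p,q}` whose Padé approximant `[p/q]_f` has no pole in
`closure Ω ∩ {|z| ≤ s}` and is `1 / (s + 1)`-close to `f` there in the derivatives of order at
most `s`. -/
def padeNear (Ω : Set ℂ) (s p q : ℕ) : Set (AInf Ω) :=
  {f | InD f.toFun p q ∧ (∀ z ∈ closurePiece Ω s, (padeDen f.toFun p q).eval z ≠ 0) ∧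
    ∀ l ≤ s, ∀ z ∈ closurePiece Ω s,
      dist (f.extDeriv l z) (iteratedDeriv l (padeQuot f.toFun p q) z) < 1 / (s + 1)}

theorem eventually_forall_dist_lt {ι α β : Type*} [TopologicalSpace α] [PseudoMetricSpace β]
    {φ : Filter ι} {u v : ι → α → β} {f g : α → β} {K : Set α} {c : ℝ} (hK : IsCompact K)
    (hf : ContinuousOn f K) (hg : ContinuousOn g K) (hu : TendstoUniformlyOn u f φ K)
    (hv : TendstoUniformlyOn v g φ K) (hfg : ∀ x ∈ K, dist (f x) (g x) < c) :
    ∀ᶠ i in φ, ∀ x ∈ K, dist (u i x) (v i x) < c := by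
  rcases K.eq_empty_or_nonempty with rfl | hne
  · simp
  obtain ⟨x₀, hx₀, hmax⟩ := hK.exists_isMaxOn hne (continuous_dist.comp_continuousOn (hf.prodMk hg))
  have hdist := uniformContinuous_dist.comp_tendstoUniformlyOn (hu.prodMk hv)
  exact (hdist.eventually_forall_lt (hfg x₀ hx₀) fun x hx => hmax hx).diag_of_prod

theorem tendstoUniformlyOn_extDeriv (f : AInf Ω) (l n : ℕ) :
    TendstoUniformlyOn (fun g : AInf Ω => g.extDeriv l) (f.extDeriv l) (𝓝 f) (closurePiece Ω n) :=
  AInf.tendsto_iff.1 tendsto_id l n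

theorem isOpen_padeNear (h0 : (0 : ℂ) ∈ Ω) (s p q : ℕ) : IsOpen (padeNear Ω s p q) := by
  refine isOpen_iff_mem_nhds.2 fun f ⟨hf, hpole, hnear⟩ => ?_
  have hK : IsCompact (closurePiece Ω s) := isCompact_closurePiece s
  refine inter_mem ((isOpen_inD h0 p q).mem_nhds hf) (inter_mem ?_ ?_)
  · exact hK.eventually_forall_of_forall_eventually fun z hz =>
      eventually_eval_padeDen_ne_zero h0 hf (hpole z hz)
  · refine (finite_Iic s).eventually_all.2 fun l hl => ?_
    exact eventually_forall_dist_lt hK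
      ((f.extDeriv_continuousOn_eqOn l).1.mono inter_subset_left)
      (continuousOn_iteratedDeriv_padeQuot hpole l) (tendstoUniformlyOn_extDeriv f l s)
      (tendstoUniformlyOn_iteratedDeriv_padeQuot h0 hf hK hpole l) (hnear l hl)

theorem BF_eq_iInter (F : Set (ℕ × ℕ)) : BF Ω F = ⋂ s, ⋃ x ∈ F, padeNear Ω s x.1 x.2 := by
  ext f
  simp only [mem_iInter, mem_iUnion₂, exists_prop]
  constructor
  · rintro ⟨p, q, N, D, hpq, hlim⟩ s
    obtain ⟨hpole, hunif⟩ := hlim _ inter_subset_left (isCompact_closurePiece s)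
    have hnear := (finite_Iic s).eventually_all.2 fun l _ =>
      Metric.tendstoUniformlyOn_iff.1 (hunif l) _ (Nat.one_div_pos_of_nat (n := s))
    obtain ⟨m, hm, hm'⟩ := (hpole.and hnear).exists
    obtain ⟨hF, hD, hpade⟩ := hpq m
    obtain ⟨hN, hD'⟩ := (isPade_iff hD).1 hpade
    simp only [hN, hD'] at hm hm'
    exact ⟨_, hF, hD, hm, hm'⟩
  · intro h
    choose x hxF hD hpole hnear using h
    refine ⟨fun m => (x m).1, fun m => (x m).2, _, _,
      fun m => ⟨hxF m, hD m, (isPade_iff (hD m)).2 ⟨rfl, rfl⟩⟩, fun K hKΩ hK => ?_⟩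
    have hpiece := eventually_subset_closurePiece hK.isBounded hKΩ
    refine ⟨hpiece.mono fun m hm z hz => hpole m z (hm hz), fun l => ?_⟩
    refine Metric.tendstoUniformlyOn_iff.2 fun ε hε => ?_
    filter_upwards [hpiece, eventually_ge_atTop l,
      tendsto_one_div_add_atTop_nhds_zero_nat.eventually_lt_const hε] with m hm hlm hmε z hz
    exact (hnear m l hlm z (hm hz)).trans hmε

theorem ofPolynomial_mem_padeNear (hΩ : IsOpen Ω) (h0 : (0 : ℂ) ∈ Ω) {P : ℂ[X]} (hP : P ≠ 0)
    (s q : ℕ) : AInf.ofPolynomial hΩ P ∈ padeNear Ω s P.natDegree q := by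
  have hcoeff := taylorCoeff_ofPolynomial hΩ h0 P
  have hD := inD_of_taylorCoeff_eq hP hcoeff q
  obtain ⟨hnum, hden⟩ := (isPade_iff hD).1 (isPade_of_taylorCoeff_eq hcoeff q)
  have hquot : padeQuot (AInf.ofPolynomial hΩ P).toFun P.natDegree q = fun z => P.eval z := by
    funext z
    rw [padeQuot, ← hnum, ← hden, eval_one, div_one]
  refine ⟨hD, fun z _ => ?_, fun l _ z hz => ?_⟩
  · rw [← hden, eval_one]
    exact one_ne_zero
  · rw [hquot, AInf.extDeriv_ofPolynomial hΩ P l hz.1, dist_self]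
    exact Nat.one_div_pos_of_nat

theorem tendsto_ofPolynomial_add_C_mul (hΩ : IsOpen Ω) (P Q : ℂ[X]) :
    Tendsto (fun ε : ℂ => AInf.ofPolynomial hΩ (P + C ε * Q)) (𝓝 0)
      (𝓝 (AInf.ofPolynomial hΩ P)) := by
  refine AInf.tendsto_iff.2 fun l n => ?_
  have hcont : Continuous (Function.uncurry fun ε z => (P + C ε * Q).eval z) := by
    simp only [Function.uncurry_def, eval_add, eval_mul, eval_C]
    fun_prop
  have h := tendstoUniformlyOn_iteratedDeriv_of_continuousAt
    (R := fun (ε : ℂ) z => (P + C ε * Q).eval z) (y₀ := 0) isOpen_univ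
    (isCompact_closurePiece (Ω := Ω) n) (subset_univ _)
    (fun z _ => hcont.continuousAt)
    (fun z _ => .of_forall fun x => (P + C x.1 * Q).differentiableAt) l
  simp only [C_0, zero_mul, add_zero] at h
  refine (h.congr (.of_forall fun ε z hz => ?_)).congr_right fun z hz => ?_
  · exact (AInf.extDeriv_ofPolynomial hΩ _ l hz.1).symm
  · exact (AInf.extDeriv_ofPolynomial hΩ _ l hz.1).symm

/-- For `n > deg P` the polynomial `P + ε X ^ n` has degree exactly `n` and is therefore its own
Padé approximant of type `[n/q]`, for every `q`. -/
theorem ofPolynomial_mem_closure_padeNear (hΩ : IsOpen Ω) (h0 : (0 : ℂ) ∈ Ω) (P : ℂ[X])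
    {n : ℕ} (hn : P.natDegree < n) (s q : ℕ) :
    AInf.ofPolynomial hΩ P ∈ closure (HClosure Ω ∩ padeNear Ω s n q) := by
  have hmem {ε : ℂ} (hε : ε ≠ 0) :
      AInf.ofPolynomial hΩ (P + C ε * X ^ n) ∈ HClosure Ω ∩ padeNear Ω s n q := by
    have hdegX : (C ε * X ^ n).natDegree = n := natDegree_C_mul_X_pow n ε hε
    have hdeg : (P + C ε * X ^ n).natDegree = n :=
      (natDegree_add_eq_right_of_natDegree_lt (hn.trans_eq hdegX.symm)).trans hdegX
    have hnear := ofPolynomial_mem_padeNear hΩ h0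
      (ne_zero_of_natDegree_gt (hn.trans_eq hdeg.symm)) s q
    rw [hdeg] at hnear
    exact ⟨AInf.ofPolynomial_mem_HClosure hΩ _, hnear⟩
  exact mem_closure_of_tendsto (b := 𝓝[≠] (0 : ℂ))
    ((tendsto_ofPolynomial_add_C_mul hΩ P (X ^ n)).mono_left nhdsWithin_le_nhds)
    (eventually_mem_nhdsWithin.mono fun ε hε => hmem hε)

theorem HClosure_subset_closure_inter_iUnion_padeNear (hΩ : IsOpen Ω) (h0 : (0 : ℂ) ∈ Ω)
    (hconn : IsConnected (((↑) : ℂ → OnePoint ℂ) '' closure Ω)ᶜ) {F : Set (ℕ × ℕ)}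
    (hF : ∀ n, ∃ x ∈ F, n < x.1) (s : ℕ) :
    HClosure Ω ⊆ closure (HClosure Ω ∩ ⋃ x ∈ F, padeNear Ω s x.1 x.2) := by
  refine (HClosure_subset_closure_range_ofPolynomial hΩ hconn).trans
    (closure_minimal ?_ isClosed_closure)
  rintro _ ⟨P, rfl⟩
  obtain ⟨x, hxF, hx⟩ := hF P.natDegree
  exact closure_mono (inter_subset_inter_right _ (subset_biUnion_of_mem hxF))
    (ofPolynomial_mem_closure_padeNear hΩ h0 P hx s x.2)

theorem dense_preimage_iUnion_padeNear (hΩ : IsOpen Ω) (h0 : (0 : ℂ) ∈ Ω)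
    (hconn : IsConnected (((↑) : ℂ → OnePoint ℂ) '' closure Ω)ᶜ) {F : Set (ℕ × ℕ)}
    (hF : ∀ n, ∃ x ∈ F, n < x.1) (s : ℕ) :
    Dense (((↑) : closure (HClosure Ω) → AInf Ω) ⁻¹' ⋃ x ∈ F, padeNear Ω s x.1 x.2) := by
  rw [Subtype.dense_iff, Subtype.image_preimage_coe]
  exact closure_minimal ((HClosure_subset_closure_inter_iUnion_padeNear hΩ h0 hconn hF s).trans
    (closure_mono (inter_subset_inter_left _ subset_closure))) isClosed_closure

end GoodSets

end PadeSmooth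

end

open PadeSmooth in
theorem theorem3p4 (Ω : Set ℂ) (hΩ : IsOpen Ω) (h0 : (0 : ℂ) ∈ Ω)
    (hconn : IsConnected ((((↑) : ℂ → OnePoint ℂ) '' closure Ω)ᶜ))
    (F : Set (ℕ × ℕ))
    (hF : ∃ s : ℕ → ℕ × ℕ, (∀ m, s m ∈ F) ∧ Tendsto (fun m => (s m).1) atTop atTop) :
    IsGδ {f : ↥(closure (PadeSmooth.HClosure Ω)) | (f : PadeSmooth.AInf Ω) ∈ PadeSmooth.BF Ω F} ∧
    Dense {f : ↥(closure (PadeSmooth.HClosure Ω)) | (f : PadeSmooth.AInf Ω) ∈ PadeSmooth.BF Ω F} ∧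
    (PadeSmooth.BF Ω F).Nonempty := by
  have := AInf.completeSpace hΩ
  have : CompleteSpace (closure (HClosure Ω)) := isClosed_closure.completeSpace_coe
  let G (s : ℕ) : Set (closure (HClosure Ω)) := (↑) ⁻¹' ⋃ x ∈ F, padeNear Ω s x.1 x.2
  have hBF : {f : closure (HClosure Ω) | (f : AInf Ω) ∈ BF Ω F} = ⋂ s, G s := by
    rw [BF_eq_iInter]
    exact preimage_iInter
  have hopen (s : ℕ) : IsOpen (G s) :=
    (isOpen_biUnion fun x _ => isOpen_padeNear h0 s x.1 x.2).preimage continuous_subtype_val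
  have hlarge (n : ℕ) : ∃ x ∈ F, n < x.1 := by
    obtain ⟨s, hsF, hs⟩ := hF
    exact (hs.eventually_gt_atTop n).exists.imp' s fun m hm => ⟨hsF m, hm⟩
  have hdense : Dense (⋂ s, G s) :=
    dense_iInter_of_isOpen hopen (dense_preimage_iUnion_padeNear hΩ h0 hconn hlarge)
  have : Nonempty (closure (HClosure Ω)) :=
    ⟨⟨_, subset_closure (AInf.ofPolynomial_mem_HClosure hΩ 0)⟩⟩
  rw [hBF]
  refine ⟨.iInter_of_isOpen hopen, hdense, ?_⟩
  obtain ⟨f, hf⟩ := hdense.nonempty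
  exact ⟨f, hBF.ge hf⟩
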